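/- Let $d\in\mathbb N$, $0<\alpha<2$, $2\le p<\infty$, and let $(\Omega,\Sigma,P)$ be a probability space. A symmetric $\alpha$-stable random measure on $[0,1]^d$ with Lebesgue control measure $|\cdot|$ is a family of real random variables $M(A)$, indexed by the Borel sets $A\subset[0,1]^d$, such that (i) $\mathbb E\,e^{itM(A)}=e^{-|A|\,|t|^\alpha}$ for all $t\in\mathbb R$; (ii) $M(A_1),\dots,M(A_k)$ are independent whenever $A_1,\dots,A_k$ are pairwise disjoint; (iii) $M(\bigcup_j A_j)=\sum_{j=1}^\infty M(A_j)$ almost surely (as a limit of partial sums) for pairwise disjoint $A_1,A_2,\dots$. The integral of a simple function is $\int\sum_i y_i1_{A_i}\,dM=\sum_i y_iM(A_i)$, and $\int f\,dM$ is the limit in probability of $\int f_k\,dM$ for simple functions $f_k\to f$ in $L^\alpha([0,1]^d)$. A random field $U=(U(x))_{x\in[0,1]^d}$ on $\Omega$ is a symmetric $\alpha$-stable random sheet if there is such an $M$ on $\Omega$ with, for every $x\in[0,1]^d$, $$U(x)=\int_{[0,1]^d} f(x,x')\,M(dx')\quad\text{almost surely},\qquad f(x,x')=\begin{cases}1 &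 \text{if } x'_i\le x_i \text{ for all } i,\\ 0&\text{otherwise.}\end{cases}$$ For $s\in\mathbb R$, $H^s_p(\mathbb R^d)$ is the space of complex tempered distributions $u$ with $\mathcal F^{-1}\big((1+|\xi|^2)^{s/2}\mathcal Fu\big)\in L^p(\mathbb R^d)$, normed by $\|\mathcal F^{-1}((1+|\xi|^2)^{s/2}\mathcal Fu)\|_{L^p}$ and equipped with its Borel $\sigma$-algebra. Here $\mathcal F\varphi(\xi)=\int e^{-2\pi i x\cdot\xi}\varphi(x)\,dx$; other normalizations of $\mathcal F$ give the same space with an equivalent norm. Theorem. Let $U$ be a symmetric $\alpha$-stable random sheet on $[0,1]^d$. Then $U$ has a jointly measurable version, that is, a Borel measurable $V:[0,1]^d\times\Omega\to\mathbb R$ with $V(x,\cdot)=U(x)$ almost surely for every $x\in[0,1]^d$. Moreover, for every such version $V$, the zero extension $$V^e(x,\omega)=\begin{cases}V(x,\omega), & x\in[0,1]^d,\\ 0,& x\in\mathbb R^d\setminus[0,1]^d,\end{cases}$$ is an $H^s_p(\mathbb R^d)$-valued random variable for every $s<\frac1p$: there is a measurable map $X:\Omega\to H^s_p(\mathbb R^d)$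 such that for almost every $\omega$ the function $V^e(\cdot,\omega)$ belongs to $L^p(\mathbb R^d)$ and, as a tempered distribution, equals $X(\omega)$. -/

import Mathlib

open MeasureTheory ProbabilityTheory TemperedDistribution Filter Set
open scoped Topology ENNReal SchwartzMap

noncomputable section

namespace StableSheet

/-! ### Bessel potential spaces -/

/-- The fractional Sobolev (Bessel potential) space `H^s_p(ℝ^d)`: the tempered distributions `u`
with `𝓕⁻¹((1 + |ξ|²)^(s/2) 𝓕 u) ∈ L^p(ℝ^d)`. It is a type of its own, since its topology is the
norm topology below and not the one induced from the tempered distributions. -/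
structure Sobolev (d : ℕ) (s : ℝ) (p : ℝ≥0∞) [Fact (1 ≤ p)] where
  /-- The underlying tempered distribution. -/
  toDistribution : 𝓢'(EuclideanSpace ℝ (Fin d), ℂ)
  memSobolev : MemSobolev s p toDistribution

namespace Sobolev

variable {d : ℕ} {s : ℝ} {p : ℝ≥0∞} [Fact (1 ≤ p)]

theorem toDistribution_injective :
    Function.Injective (toDistribution : Sobolev d s p → 𝓢'(EuclideanSpace ℝ (Fin d), ℂ)) := by
  rintro ⟨u, hu⟩ ⟨v, hv⟩ h
  cases h
  rfl

instance : Zero (Sobolev d s p) := ⟨⟨0, memSobolev_fun_zero _ _ s p⟩⟩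
instance : Add (Sobolev d s p) := ⟨fun u v => ⟨_, u.memSobolev.add v.memSobolev⟩⟩
instance : Neg (Sobolev d s p) := ⟨fun u => ⟨_, u.memSobolev.neg⟩⟩
instance : Sub (Sobolev d s p) := ⟨fun u v => ⟨_, u.memSobolev.sub v.memSobolev⟩⟩
instance : SMul ℂ (Sobolev d s p) := ⟨fun c u => ⟨_, u.memSobolev.smul c⟩⟩
instance : SMul ℕ (Sobolev d s p) :=
  ⟨fun n u => ⟨n • u.toDistribution, by
    simpa [Nat.cast_smul_eq_nsmul] using u.memSobolev.smul (n : ℂ)⟩⟩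
instance : SMul ℤ (Sobolev d s p) :=
  ⟨fun n u => ⟨n • u.toDistribution, by
    simpa [Int.cast_smul_eq_zsmul] using u.memSobolev.smul (n : ℂ)⟩⟩

instance : AddCommGroup (Sobolev d s p) :=
  toDistribution_injective.addCommGroup _ rfl (fun _ _ => rfl) (fun _ => rfl) (fun _ _ => rfl)
    (fun _ _ => rfl) (fun _ _ => rfl)

/-- The inclusion of `H^s_p(ℝ^d)` into the tempered distributions, as an additive map. -/
def toDistributionHom : Sobolev d s p →+ 𝓢'(EuclideanSpace ℝ (Fin d), ℂ) where
  toFun := toDistribution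
  map_zero' := rfl
  map_add' _ _ := rfl

instance : Module ℂ (Sobolev d s p) :=
  toDistribution_injective.module ℂ toDistributionHom (fun _ _ => rfl)

theorem toTemperedDistribution_injective :
    Function.Injective (Lp.toTemperedDistribution :
      Lp ℂ p (volume : Measure (EuclideanSpace ℝ (Fin d))) → 𝓢'(EuclideanSpace ℝ (Fin d), ℂ)) :=
  LinearMap.ker_eq_bot.mp (Lp.ker_toTemperedDistributionCLM_eq_bot
    (F := ℂ) (μ := (volume : Measure (EuclideanSpace ℝ (Fin d)))) (p := p))

/-- The function `𝓕⁻¹((1 + |ξ|²)^(s/2) 𝓕 u) ∈ L^p(ℝ^d)`, for `u ∈ H^s_p(ℝ^d)`. -/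
def toLpFun (u : Sobolev d s p) : Lp ℂ p (volume : Measure (EuclideanSpace ℝ (Fin d))) :=
  u.memSobolev.choose

theorem besselPotential_eq (u : Sobolev d s p) :
    besselPotential (EuclideanSpace ℝ (Fin d)) ℂ s u.toDistribution =
      Lp.toTemperedDistribution u.toLpFun :=
  u.memSobolev.choose_spec

/-- `u ↦ 𝓕⁻¹((1 + |ξ|²)^(s/2) 𝓕 u)` as a linear bijection of `H^s_p(ℝ^d)` onto `L^p(ℝ^d)`. -/
def toLpEquiv : Sobolev d s p ≃ₗ[ℂ] Lp ℂ p (volume : Measure (EuclideanSpace ℝ (Fin d))) :=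
  LinearEquiv.ofBijective
    { toFun := toLpFun
      map_add' := fun u v => toTemperedDistribution_injective <| by
        rw [← besselPotential_eq, ← Lp.toTemperedDistributionCLM_apply, map_add,
          Lp.toTemperedDistributionCLM_apply, Lp.toTemperedDistributionCLM_apply,
          ← besselPotential_eq, ← besselPotential_eq, ← map_add]
        rfl
      map_smul' := fun c u => toTemperedDistribution_injective <| by
        rw [← besselPotential_eq, ← Lp.toTemperedDistributionCLM_apply, map_smul,
          Lp.toTemperedDistributionCLM_apply, RingHom.id_apply, ← besselPotential_eq, ← map_smul]
        rfl }
    ⟨fun u v h => toDistribution_injective <| by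
        have h' : u.toLpFun = v.toLpFun := h
        have := (besselPotential_eq u).trans ((congrArg _ h').trans (besselPotential_eq v).symm)
        simpa using congrArg (besselPotential (EuclideanSpace ℝ (Fin d)) ℂ (-s)) this,
     fun f => by
        have hf : besselPotential (EuclideanSpace ℝ (Fin d)) ℂ s
            (besselPotential (EuclideanSpace ℝ (Fin d)) ℂ (-s) (Lp.toTemperedDistribution f)) =
            Lp.toTemperedDistribution f := by simp
        refine ⟨⟨_, f, hf⟩, toTemperedDistribution_injective ?_⟩
        exact (besselPotential_eq _).symm.trans hf⟩

/-- The norm `‖𝓕⁻¹((1 + |ξ|²)^(s/2) 𝓕 u)‖_{L^p}` of `H^s_p(ℝ^d)`. -/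
instance : NormedAddCommGroup (Sobolev d s p) :=
  NormedAddCommGroup.induced _ _ (toLpEquiv (d := d) (s := s) (p := p)).toLinearMap
    toLpEquiv.injective

instance : NormedSpace ℂ (Sobolev d s p) :=
  NormedSpace.induced ℂ _ _ (toLpEquiv (d := d) (s := s) (p := p)).toLinearMap

theorem norm_eq (u : Sobolev d s p) : ‖u‖ = ‖u.toLpFun‖ := rfl

/-- `H^s_p(ℝ^d)` carries its Borel σ-algebra. -/
instance : MeasurableSpace (Sobolev d s p) := borel _

instance : BorelSpace (Sobolev d s p) := ⟨rfl⟩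

end Sobolev

/-! ### Stable random measures and stochastic integrals -/

/-- `μ` is the symmetric `α`-stable law `S_α(σ, 0, 0)` on the real line: its characteristic
function is `t ↦ exp(-σ^α |t|^α)`. -/
def IsSymStable (α σ : ℝ) (μ : Measure ℝ) : Prop :=
  ∀ t : ℝ, charFun μ t = Complex.exp (-((σ ^ α * |t| ^ α : ℝ) : ℂ))

/-- `M` is a symmetric `α`-stable random measure on `E` with control measure `m`: an independently
scattered, `σ`-additive family of random variables, indexed by the measurable sets of finite
`m`-measure (the values of `M` at other sets are irrelevant), such that `M A` has the law
`S_α((m A)^(1/α), 0, 0)`. -/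
structure IsSymStableRandomMeasure {E Ω : Type*} [MeasurableSpace E] [MeasurableSpace Ω]
    (α : ℝ) (m : Measure E) (P : Measure Ω) (M : Set E → Ω → ℝ) : Prop where
  measurable : ∀ A, MeasurableSet A → m A < ∞ → Measurable (M A)
  law : ∀ A, MeasurableSet A → m A < ∞ → IsSymStable α ((m A).toReal ^ (1 / α)) (P.map (M A))
  indep : ∀ (n : ℕ) (A : Fin n → Set E), (∀ i, MeasurableSet (A i)) → (∀ i, m (A i) < ∞) →
    Pairwise (fun i j => Disjoint (A i) (A j)) → iIndepFun (fun i => M (A i)) P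
  sigmaAdditive : ∀ A : ℕ → Set E, (∀ j, MeasurableSet (A j)) → (∀ j, m (A j) < ∞) →
    Pairwise (fun i j => Disjoint (A i) (A j)) → m (⋃ j, A j) < ∞ →
    ∀ᵐ ω ∂P, Tendsto (fun n => ∑ j ∈ Finset.range n, M (A j) ω) atTop (𝓝 (M (⋃ j, A j) ω))

/-- The integral `∑_y y M({g = y})` of a simple function `g`. -/
def simpleIntegral {E Ω : Type*} [MeasurableSpace E] (M : Set E → Ω → ℝ) (g : SimpleFunc E ℝ) :
    Ω → ℝ :=
  fun ω => ∑ y ∈ g.range, y * M (g ⁻¹' {y}) ω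

/-- The random variable `X` is (a version of) the stochastic integral `∫ f dM`: it is the limit
in probability of the integrals of simple functions, with supports of finite measure, which
converge to `f` in `L^α(E, m)`. -/
def IsStochasticIntegral {E Ω : Type*} [MeasurableSpace E] [MeasurableSpace Ω] (α : ℝ)
    (m : Measure E) (P : Measure Ω) (M : Set E → Ω → ℝ) (f : E → ℝ) (X : Ω → ℝ) : Prop :=
  ∃ g : ℕ → SimpleFunc E ℝ, (∀ k, m (Function.support (g k)) < ∞) ∧
    Tendsto (fun k => eLpNorm (fun x => f x - g k x) (ENNReal.ofReal α) m) atTop (𝓝 0) ∧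
    TendstoInMeasure P (fun k => simpleIntegral M (g k)) atTop X

/-! ### The symmetric stable random sheet -/

/-- The cube `[0,1]^d`. -/
def unitCube (d : ℕ) : Set (EuclideanSpace ℝ (Fin d)) := {x | ∀ i, x i ∈ Icc (0 : ℝ) 1}

/-- Lebesgue measure on the cube `[0,1]^d`. -/
def lebesgue (d : ℕ) : Measure (unitCube d) := Measure.comap Subtype.val volume

/-- The kernel `f(x, x')` which is `1` if `x'_i ≤ x_i` for all `i`, and `0` otherwise. -/
def sheetKernel {d : ℕ} (x : unitCube d) : unitCube d → ℝ :=
  indicator {x' | ∀ i, x'.1 i ≤ x.1 i} 1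

/-- The random field `U` on `[0,1]^d` is a symmetric `α`-stable random sheet: for every `x`, up to
a `P`-null set, `U(x) = ∫_{[0,1]^d} f(x, x') M(dx')` for a symmetric `α`-stable random measure `M`
on `[0,1]^d` with Lebesgue measure as control measure. -/
structure IsSymStableSheet {d : ℕ} {Ω : Type*} [MeasurableSpace Ω] (α : ℝ) (P : Measure Ω)
    (U : unitCube d → Ω → ℝ) : Prop where
  measurable : ∀ x, Measurable (U x)
  exists_integral : ∃ M : Set (unitCube d) → Ω → ℝ,
    IsSymStableRandomMeasure α (lebesgue d) P M ∧
      ∀ x, IsStochasticIntegral α (lebesgue d) P M (sheetKernel x) (U x)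

/-- `V` is a jointly measurable version of the random field `U`. -/
structure IsMeasurableVersion {d : ℕ} {Ω : Type*} [MeasurableSpace Ω] (P : Measure Ω)
    (U V : unitCube d → Ω → ℝ) : Prop where
  measurable : Measurable (Function.uncurry V)
  ae_eq : ∀ x, V x =ᵐ[P] U x

/-- The zero extension to `ℝ^d` of the sample path at `ω`, as a complex-valued function. -/
def zeroExtension {d : ℕ} {Ω : Type*} (V : unitCube d → Ω → ℝ) (ω : Ω) :
    EuclideanSpace ℝ (Fin d) → ℂ :=
  Function.extend Subtype.val (fun x : unitCube d => (V x ω : ℂ)) 0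

end StableSheet

end

/-! For fixed `x`, the sheet is `U(x) = M([0,x])` almost surely. Reading the kernel as a function of
its first argument, `x ↦ f(x,y)` is the indicator of the box `[y,1]`, so the whole path should be
the vector-valued integral `∫ 1_{[y,1]} M(dy)`. The proof gives this integral a meaning in `H^s_p`
and identifies it with the path.

Two facts make the integral converge. First, `y ↦ 1_{[y,1]}` is Hölder continuous into `H^s_p` for
`s < 1/p` (`exists_boxVec`). The Fourier transform of a box is a product of one-dimensional
integrals decaying like `1/|ξ_i|`; a small part of this decay is traded for a power of the distance
between corners, and the rest still beats the weight `(1+|ξ|²)^(s/2)`. A lossy Hausdorff–Young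
inequality (`exists_fourierInv_mem_Lp`) returns from the Fourier side to `L^p`.

Secondly, `H^s_p` is isometric to `L^p`, whose norm is 2-smooth for `2 ≤ p < ∞` (`isTwoSmooth_Lp`).
In such a space truncation and a second moment bound yield `P(‖∫ F dM‖ > t) ≤ C t^(-α) ∫ ‖F‖^α dm`
for finitely valued integrands (`measure_norm_vectorIntegral_gt_le`).

Now replace `y` by its dyadic corner. By the two facts, consecutive discretized integrals differ by
more than `ρ^n` with geometrically small probability, so by Borel–Cantelli they are almost surely
Cauchy, both in `H^s_p` and in `L^p` (`ae_cauchySeq_vectorIntegral`). As functions they are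
discretized sheets, which for each `x` converge almost surely to `U(x)` because `M` is continuous
from above. Their limsup is a measurable version. For any measurable version `V`, Fubini turns this
into convergence to `V` for almost every `x`, so the `L^p` limit is the zero extension of `V`, and
the `H^s_p` limit is the same distribution. -/

noncomputable section

namespace StableSheet

/-! ### Inverse Fourier transforms in `L^p`, `2 ≤ p < ∞` -/

section Fourier

open FourierTransform Real

variable {E : Type*} [NormedAddCommGroup E] [InnerProductSpace ℝ E] [FiniteDimensional ℝ E]
  [MeasurableSpace E] [BorelSpace E]

theorem integral_mul_fourierInv {g : E → ℂ} (hg : Integrable g) (φ : 𝓢(E, ℂ)) :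
    ∫ x, φ x • 𝓕⁻ g x = ∫ ξ, (𝓕⁻ φ) ξ • g ξ := by
  have h := VectorFourier.integral_fourierIntegral_smul_eq_flip (L := -innerₗ E) (f := ⇑φ) (g := g)
    Real.continuous_fourierChar (continuous_inner.neg) (φ.integrable (μ := volume)) hg
  have h1 : VectorFourier.fourierIntegral 𝐞 volume (-innerₗ E) (⇑φ) = ⇑(𝓕⁻ φ : 𝓢(E, ℂ)) := by
    rw [SchwartzMap.fourierInv_coe]; rfl
  have h2 : VectorFourier.fourierIntegral 𝐞 volume (-innerₗ E).flip g = 𝓕⁻ g := by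
    have : (-innerₗ E).flip = -innerₗ E := by
      ext x y; simp [real_inner_comm]
    rw [this]; rfl
  rw [h1, h2] at h
  exact h.symm

theorem integral_mul_fourier {g : E → ℂ} (hg : Integrable g) (φ : 𝓢(E, ℂ)) :
    ∫ x, φ x • 𝓕 g x = ∫ ξ, (𝓕 φ) ξ • g ξ := by
  have h := VectorFourier.integral_fourierIntegral_smul_eq_flip (L := innerₗ E) (f := ⇑φ) (g := g)
    Real.continuous_fourierChar continuous_inner (φ.integrable (μ := volume)) hg
  have h1 : VectorFourier.fourierIntegral 𝐞 volume (innerₗ E) (⇑φ) = ⇑(𝓕 φ : 𝓢(E, ℂ)) := by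
    rw [SchwartzMap.fourier_coe]; rfl
  have h2 : VectorFourier.fourierIntegral 𝐞 volume (innerₗ E).flip g = 𝓕 g := by
    have : (innerₗ E).flip = innerₗ E := by
      ext x y; simp
    rw [this]; rfl
  rw [h1, h2] at h
  exact h.symm

theorem continuous_fourierInv {g : E → ℂ} (hg : Integrable g) : Continuous (𝓕⁻ g) :=
  VectorFourier.fourierIntegral_continuous Real.continuous_fourierChar
    (L := -innerₗ E) continuous_inner.neg hg

theorem enorm_fourierInv_le (g : E → ℂ) (x : E) : ‖𝓕⁻ g x‖ₑ ≤ ∫⁻ ξ, ‖g ξ‖ₑ := by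
  rw [Real.fourierInv_eq]
  refine (enorm_integral_le_lintegral_enorm _).trans_eq ?_
  congr with v
  rw [Circle.smul_def, enorm_smul, ← ofReal_norm, Circle.norm_coe]
  simp

/-- The inverse Fourier integral of a function in `L¹ ∩ L²` represents its inverse `L²`-Fourier
transform. -/
theorem fourierInv_ae_eq {g : E → ℂ} (hg : Integrable g) (hg2 : MemLp g 2) :
    𝓕⁻ g =ᵐ[volume] (𝓕⁻ (hg2.toLp g : Lp (α := E) ℂ 2 volume) : Lp (α := E) ℂ 2 volume) := by
  apply ae_eq_of_integral_contDiff_smul_eq (continuous_fourierInv hg).locallyIntegrable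
    ((Lp.memLp _).locallyIntegrable (by norm_num))
  intro φ hφ hφc
  -- Real test functions suffice for almost everywhere equality; made complex, they are Schwartz
  -- functions, on which both transforms can be moved across the pairing.
  have hc₁ : HasCompactSupport (Complex.ofRealCLM ∘ φ) := hφc.comp_left rfl
  have hc₂ : ContDiff ℝ (⊤ : ℕ∞) (Complex.ofRealCLM ∘ φ) := by fun_prop
  have key : ∀ ψ : 𝓢(E, ℂ), ∫ x, ψ x • 𝓕⁻ g x =
      ∫ x, ψ x • ((𝓕⁻ (hg2.toLp g : Lp (α := E) ℂ 2 volume) : Lp (α := E) ℂ 2 volume) : E → ℂ) x := by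
    intro ψ
    rw [integral_mul_fourierInv hg, ← Lp.toTemperedDistribution_apply,
      ← Lp.fourierInv_toTemperedDistribution_eq, TemperedDistribution.fourierInv_apply,
      Lp.toTemperedDistribution_apply]
    refine integral_congr_ae ?_
    filter_upwards [hg2.coeFn_toLp] with x hx
    rw [hx]
  simpa using key (hc₁.toSchwartzMap hc₂)

theorem lintegral_fourierInv_sq {g : E → ℂ} (hg : Integrable g) (hg2 : MemLp g 2) :
    ∫⁻ x, ‖𝓕⁻ g x‖ₑ ^ (2 : ℝ) = ∫⁻ ξ, ‖g ξ‖ₑ ^ (2 : ℝ) := by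
  have h1 : eLpNorm (𝓕⁻ g) 2 = eLpNorm g 2 := by
    rw [eLpNorm_congr_ae (fourierInv_ae_eq hg hg2), ← eLpNorm_congr_ae hg2.coeFn_toLp]
    have : ‖(𝓕⁻ (hg2.toLp g : Lp (α := E) ℂ 2 volume) : Lp (α := E) ℂ 2 volume)‖ₑ =
        ‖(hg2.toLp g : Lp (α := E) ℂ 2 volume)‖ₑ := by
      rw [← ofReal_norm, ← ofReal_norm]
      congr 1
      exact (Lp.fourierTransformₗᵢ E ℂ).symm.norm_map (hg2.toLp g)
    simpa [Lp.enorm_def] using this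
  rw [eLpNorm_eq_lintegral_rpow_enorm_toReal (by norm_num) (by norm_num),
    eLpNorm_eq_lintegral_rpow_enorm_toReal (by norm_num) (by norm_num)] at h1
  simp only [ENNReal.toReal_ofNat] at h1
  exact ENNReal.rpow_left_injective (x := 1 / 2) (by norm_num) h1

/-- Of the `q` powers, `q - 2` are bounded by the sup norm, hence by `‖g‖₁`, and the remaining two
are handled by Plancherel. -/
theorem lintegral_fourierInv_rpow_le {g : E → ℂ} (hg : Integrable g) (hg2 : MemLp g 2) {q : ℝ}
    (hq : 2 ≤ q) :
    ∫⁻ x, ‖𝓕⁻ g x‖ₑ ^ q ≤ (∫⁻ ξ, ‖g ξ‖ₑ) ^ (q - 2) * ∫⁻ ξ, ‖g ξ‖ₑ ^ (2 : ℝ) := by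
  rw [← lintegral_fourierInv_sq hg hg2, ← lintegral_const_mul'']
  · refine lintegral_mono fun x => ?_
    calc ‖𝓕⁻ g x‖ₑ ^ q = ‖𝓕⁻ g x‖ₑ ^ (q - 2) * ‖𝓕⁻ g x‖ₑ ^ (2 : ℝ) := by
          rw [← ENNReal.rpow_add_of_nonneg _ _ (by linarith) (by norm_num)]; ring_nf
      _ ≤ _ := by
          gcongr
          exact enorm_fourierInv_le g x
  · exact ((continuous_fourierInv hg).aestronglyMeasurable.enorm).pow_const _

/-- The `L^p`-norm of the inverse Fourier transform of a function bounded by `c` which lives on a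
set of finite measure. -/
theorem eLpNorm_fourierInv_le_of_support {g : E → ℂ} (hg : AEStronglyMeasurable g) {S : Set E}
    (hS : MeasurableSet S) (hSf : volume S ≠ ∞) {c : ℝ} (hc : 0 ≤ c) (hgc : ∀ ξ ∈ S, ‖g ξ‖ ≤ c)
    {p : ℝ≥0∞} (hp : 2 ≤ p) (hp_top : p ≠ ∞) :
    MemLp (𝓕⁻ (S.indicator g)) p ∧ eLpNorm (𝓕⁻ (S.indicator g)) p volume ≤
      ENNReal.ofReal (c * (volume S).toReal ^ (1 - 1 / p.toReal)) := by
  have hq : 2 ≤ p.toReal := by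
    simpa using ENNReal.toReal_mono hp_top hp
  have hb : MemLp (S.indicator g) ∞ := by
    refine memLp_top_of_bound (hg.indicator hS) c (ae_of_all _ fun ξ => ?_)
    by_cases h : ξ ∈ S <;> simp [h, hgc, hc]
  have hfin : ∀ r : ℝ≥0∞, MemLp (S.indicator g) r := fun r =>
    (memLp_indicator_iff_restrict hS).2 <| by
      have : IsFiniteMeasure (volume.restrict S) := ⟨by simpa using hSf.lt_top⟩
      exact ((memLp_indicator_iff_restrict hS).1 hb).mono_exponent le_top
  have hint : Integrable (S.indicator g) := memLp_one_iff_integrable.1 (hfin 1)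
  have hle : ∀ ξ, ‖S.indicator g ξ‖ₑ ≤ S.indicator (fun _ => ENNReal.ofReal c) ξ := fun ξ => by
    by_cases h : ξ ∈ S
    · simp only [h, indicator_of_mem]
      rw [← ofReal_norm]
      exact ENNReal.ofReal_le_ofReal (hgc ξ h)
    · simp [h]
  have h1 : ∫⁻ ξ, ‖S.indicator g ξ‖ₑ ≤ ENNReal.ofReal c * volume S := by
    refine (lintegral_mono hle).trans_eq ?_
    rw [lintegral_indicator_const hS]
  have h2 : ∫⁻ ξ, ‖S.indicator g ξ‖ₑ ^ (2 : ℝ) ≤ ENNReal.ofReal c ^ (2 : ℝ) * volume S := by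
    rw [← lintegral_indicator_const hS]
    refine lintegral_mono fun ξ => ?_
    refine (ENNReal.rpow_le_rpow (hle ξ) (by norm_num)).trans ?_
    by_cases h : ξ ∈ S <;> simp [h]
  have hmain := (lintegral_fourierInv_rpow_le hint (hfin 2) hq).trans
    (mul_le_mul' (ENNReal.rpow_le_rpow h1 (by linarith)) h2)
  -- With `V = volume S` this is `(cV)^(p-2) · c²V = c^p V^(p-1)`, the `p`-th power of the claimed
  -- bound.
  have hEq : (ENNReal.ofReal c * volume S) ^ (p.toReal - 2) *
      (ENNReal.ofReal c ^ (2 : ℝ) * volume S) =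
      (ENNReal.ofReal (c * (volume S).toReal ^ (1 - 1 / p.toReal))) ^ p.toReal := by
    obtain ⟨m, hm⟩ : ∃ m : ℝ, m = (volume S).toReal := ⟨_, rfl⟩
    have hm0 : 0 ≤ m := hm ▸ ENNReal.toReal_nonneg
    rw [← ENNReal.ofReal_toReal hSf, ENNReal.toReal_ofReal ENNReal.toReal_nonneg, ← hm,
      ← ENNReal.ofReal_mul hc, ENNReal.ofReal_rpow_of_nonneg (by positivity) (by linarith),
      ENNReal.ofReal_rpow_of_nonneg hc (by norm_num), ← ENNReal.ofReal_mul (by positivity),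
      ← ENNReal.ofReal_mul (by positivity),
      ENNReal.ofReal_rpow_of_nonneg (by positivity) (by linarith)]
    congr 1
    rw [Real.mul_rpow hc hm0, Real.mul_rpow hc (by positivity), ← Real.rpow_mul hm0]
    have e1 : c ^ p.toReal = c ^ (p.toReal - 2) * c ^ (2 : ℝ) := by
      rw [← Real.rpow_add_of_nonneg hc (by linarith) (by norm_num)]; ring_nf
    have e2 : m ^ ((1 - 1 / p.toReal) * p.toReal) = m ^ (p.toReal - 2) * m := by
      have : (1 - 1 / p.toReal) * p.toReal = (p.toReal - 2) + 1 := by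
        field_simp; ring
      rw [this, Real.rpow_add_of_nonneg hm0 (by linarith) (by norm_num), Real.rpow_one]
    rw [e1, e2]; ring
  have hle' : eLpNorm (𝓕⁻ (S.indicator g)) p volume ≤
      ENNReal.ofReal (c * (volume S).toReal ^ (1 - 1 / p.toReal)) := by
    rw [eLpNorm_eq_lintegral_rpow_enorm_toReal (by positivity) hp_top]
    refine (ENNReal.rpow_le_rpow (hmain.trans_eq hEq) (by positivity)).trans_eq ?_
    rw [← ENNReal.rpow_mul, mul_one_div_cancel (by positivity), ENNReal.rpow_one]
  exact ⟨⟨(continuous_fourierInv hint).aestronglyMeasurable, hle'.trans_lt ENNReal.ofReal_lt_top⟩,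
    hle'⟩

/-- A Hausdorff–Young inequality with a loss: functions dominated by `G ∈ L^r`, where
`r < p / (p - 1)`, have an inverse Fourier transform in `L^p`. -/
theorem exists_fourierInv_mem_Lp {p : ℝ≥0∞} [Fact (1 ≤ p)] (hp : 2 ≤ p) (hp_top : p ≠ ∞)
    {G : E → ℝ} (hG : Measurable G) (hG0 : ∀ ξ, 0 < G ξ) (hG1 : ∀ ξ, G ξ ≤ 1) {r : ℝ} (hr : 0 < r)
    (hGr : Integrable fun ξ => G ξ ^ r) (hrp : r * (1 - 1 / p.toReal) < 1) :
    ∃ C : ℝ, 0 ≤ C ∧ ∀ (K : ℝ) (g : E → ℂ), 0 ≤ K → AEStronglyMeasurable g →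
      (∀ ξ, ‖g ξ‖ ≤ K * G ξ) → ∃ f : Lp (α := E) ℂ p, ‖f‖ ≤ C * K ∧
        ∀ φ : 𝓢(E, ℂ), Lp.toTemperedDistribution f φ = ∫ ξ, (𝓕⁻ φ) ξ • g ξ := by
  have hq : 2 ≤ p.toReal := by simpa using ENNReal.toReal_mono hp_top hp
  have hq1 : 0 ≤ 1 - 1 / p.toReal := by
    rw [sub_nonneg, div_le_one (by linarith)]; linarith
  -- Dyadic level sets of `G`. On `D k` one has `‖g‖ ≤ K 2^(-k)`, and Markov's inequality for `G^r`
  -- bounds the volume by `2^(r(k+1)) A`.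
  let D : ℕ → Set E := fun k => {ξ | (2 : ℝ)⁻¹ ^ (k + 1) < G ξ ∧ G ξ ≤ (2 : ℝ)⁻¹ ^ k}
  have hDm : ∀ k, MeasurableSet (D k) := fun k =>
    (measurableSet_lt measurable_const hG).inter (measurableSet_le hG measurable_const)
  have hDd : Pairwise (Function.onFun Disjoint D) := by
    have : ∀ i j, i < j → Disjoint (D i) (D j) := by
      intro i j hij
      rw [Set.disjoint_left]
      rintro ξ ⟨h1, -⟩ ⟨-, h2⟩
      have : (2 : ℝ)⁻¹ ^ j ≤ 2⁻¹ ^ (i + 1) :=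
        pow_le_pow_of_le_one (by norm_num) (by norm_num) hij
      linarith
    intro i j hij
    rcases lt_or_gt_of_ne hij with h | h
    exacts [this i j h, (this j i h).symm]
  have hDU : ⋃ k, D k = univ := by
    refine eq_univ_of_forall fun ξ => mem_iUnion.2 ?_
    obtain ⟨n, hn1, hn2⟩ := exists_nat_pow_near_of_lt_one (hG0 ξ) (hG1 ξ)
      (y := (2 : ℝ)⁻¹) (by norm_num) (by norm_num)
    exact ⟨n, hn1, hn2⟩
  obtain ⟨A, hA⟩ : ∃ A : ℝ, A = ∫ ξ, G ξ ^ r := ⟨_, rfl⟩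
  have hA0 : 0 ≤ A := hA ▸ integral_nonneg fun ξ => (Real.rpow_pos_of_pos (hG0 ξ) r).le
  have hDfin : ∀ k, volume (D k) ≠ ∞ ∧ (volume (D k)).toReal ≤ ((2 : ℝ) ^ r) ^ (k + 1) * A := by
    intro k
    have h0 : (0 : ℝ) < ((2 : ℝ)⁻¹ ^ (k + 1)) ^ r := by positivity
    have hsub : D k ⊆ {ξ | ((2 : ℝ)⁻¹ ^ (k + 1)) ^ r ≤ G ξ ^ r} := fun ξ hξ =>
      Real.rpow_le_rpow (by positivity) hξ.1.le hr.le
    have hfin := hGr.measure_ge_lt_top h0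
    have hM := mul_meas_ge_le_integral_of_nonneg
      (ae_of_all _ fun ξ => (Real.rpow_pos_of_pos (hG0 ξ) r).le) hGr (((2 : ℝ)⁻¹ ^ (k + 1)) ^ r)
    refine ⟨((measure_mono hsub).trans_lt hfin).ne, ?_⟩
    have h3 : (volume (D k)).toReal ≤
        (volume {ξ | ((2 : ℝ)⁻¹ ^ (k + 1)) ^ r ≤ G ξ ^ r}).toReal :=
      ENNReal.toReal_mono hfin.ne (measure_mono hsub)
    have h4 : ((2 : ℝ)⁻¹ ^ (k + 1)) ^ r * ((2 : ℝ) ^ r) ^ (k + 1) = 1 := by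
      rw [← Real.rpow_natCast, ← Real.rpow_natCast ((2 : ℝ) ^ r), ← Real.rpow_mul (by norm_num),
        ← Real.rpow_mul (by norm_num), Real.inv_rpow (by norm_num), mul_comm r]
      exact inv_mul_cancel₀ (by positivity)
    have h5 : (0 : ℝ) < ((2 : ℝ) ^ r) ^ (k + 1) := by positivity
    calc (volume (D k)).toReal
        ≤ (volume {ξ | ((2 : ℝ)⁻¹ ^ (k + 1)) ^ r ≤ G ξ ^ r}).toReal := h3
      _ = ((2 : ℝ) ^ r) ^ (k + 1) * (((2 : ℝ)⁻¹ ^ (k + 1)) ^ r *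
            (volume {ξ | ((2 : ℝ)⁻¹ ^ (k + 1)) ^ r ≤ G ξ ^ r}).toReal) := by
          rw [← mul_assoc, mul_comm (((2 : ℝ) ^ r) ^ (k + 1)), h4, one_mul]
      _ ≤ _ := by
          rw [hA]
          exact mul_le_mul_of_nonneg_left hM h5.le
  obtain ⟨κ, hκ⟩ : ∃ κ : ℝ, κ = 1 - 1 / p.toReal := ⟨_, rfl⟩
  rw [← hκ] at hq1 hrp
  -- The piece on `D k` has `L^p` norm at most `K 2^(-k) (2^(r(k+1)) A)^κ = B ρ^k K`. The ratio is
  -- `ρ = 2^(rκ-1)`, and `rκ < 1` makes the series of pieces converge absolutely.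
  obtain ⟨ρ, hρ⟩ : ∃ ρ : ℝ, ρ = 2⁻¹ * ((2 : ℝ) ^ r) ^ κ := ⟨_, rfl⟩
  have hρ0 : 0 ≤ ρ := by rw [hρ]; positivity
  have hρ1 : ρ < 1 := by
    rw [hρ, ← Real.rpow_mul (by norm_num), inv_mul_lt_iff₀ (by norm_num), mul_one]
    calc (2 : ℝ) ^ (r * κ) < 2 ^ (1 : ℝ) := Real.rpow_lt_rpow_of_exponent_lt (by norm_num) hrp
      _ = 2 := Real.rpow_one 2
  obtain ⟨B, hB⟩ : ∃ B : ℝ, B = (2 ^ r * A) ^ κ := ⟨_, rfl⟩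
  have hB0 : 0 ≤ B := by rw [hB]; positivity
  have hsum := (hasSum_geometric_of_lt_one hρ0 hρ1).mul_left B
  refine ⟨B * (1 - ρ)⁻¹, mul_nonneg hB0 (inv_nonneg.2 (by linarith)), fun K g hK hg hgG => ?_⟩
  have hpc : ∀ k, MemLp (𝓕⁻ ((D k).indicator g)) p ∧ eLpNorm (𝓕⁻ ((D k).indicator g)) p volume ≤
      ENNReal.ofReal (B * ρ ^ k * K) := by
    intro k
    obtain ⟨h1, h2⟩ := eLpNorm_fourierInv_le_of_support hg (hDm k) (hDfin k).1
      (c := K * 2⁻¹ ^ k) (by positivity)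
      (fun ξ hξ => (hgG ξ).trans (mul_le_mul_of_nonneg_left hξ.2 hK)) hp hp_top
    refine ⟨h1, h2.trans (ENNReal.ofReal_le_ofReal ?_)⟩
    rw [← hκ]
    calc K * 2⁻¹ ^ k * (volume (D k)).toReal ^ κ
        ≤ K * 2⁻¹ ^ k * (((2 : ℝ) ^ r) ^ (k + 1) * A) ^ κ := by
          gcongr
          exact (hDfin k).2
      _ = B * ρ ^ k * K := by
          have e : (((2 : ℝ) ^ r) ^ (k + 1) * A) ^ κ = (((2 : ℝ) ^ r) ^ κ) ^ k * B := by
            rw [hB, pow_succ, mul_assoc, Real.mul_rpow (by positivity) (by positivity),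
              ← Real.rpow_natCast, ← Real.rpow_natCast _ k, ← Real.rpow_mul (x := 2 ^ r) (by positivity),
              ← Real.rpow_mul (x := 2 ^ r) (by positivity), mul_comm κ]
          rw [e, hρ, mul_pow]; ring
  let F : ℕ → Lp (α := E) ℂ p := fun k => (hpc k).1.toLp
  have hF : ∀ k, ‖F k‖ ≤ B * ρ ^ k * K := fun k => by
    rw [Lp.norm_toLp]
    exact ENNReal.toReal_le_of_le_ofReal (by positivity) (hpc k).2
  have hsumK := hsum.mul_right K
  have hFs : Summable F := Summable.of_norm_bounded hsumK.summable hF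
  refine ⟨∑' k, F k, tsum_of_norm_bounded hsumK hF, fun φ => ?_⟩
  have hint : Integrable fun ξ => (𝓕⁻ φ) ξ • g ξ := by
    refine Integrable.mono' ((𝓕⁻ φ).integrable.norm.mul_const K)
      ((𝓕⁻ φ).integrable.aestronglyMeasurable.smul hg) (ae_of_all _ fun ξ => ?_)
    rw [norm_smul]
    have := (hgG ξ).trans (mul_le_mul_of_nonneg_left (hG1 ξ) hK)
    rw [mul_one] at this
    gcongr
  have hS1 : HasSum (fun k => Lp.toTemperedDistribution (F k) φ)
      (Lp.toTemperedDistribution (∑' k, F k) φ) := by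
    have h := hFs.hasSum.mapL (Lp.toTemperedDistributionCLM ℂ (volume : Measure E) p)
    exact h.mapL (PointwiseConvergenceCLM.evalCLM (RingHom.id ℂ) ℂ φ)
  have hS2 : HasSum (fun k => ∫ ξ in D k, (𝓕⁻ φ) ξ • g ξ) (∫ ξ, (𝓕⁻ φ) ξ • g ξ) := by
    have := hasSum_integral_iUnion (f := fun ξ => (𝓕⁻ φ) ξ • g ξ) hDm hDd
      (by rw [hDU]; exact hint.integrableOn)
    rwa [hDU, setIntegral_univ] at this
  refine hS1.unique ?_
  convert hS2 using 2 with k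
  have hgi : Integrable ((D k).indicator g) := by
    refine (integrable_indicator_iff (hDm k)).2 ?_
    refine Measure.integrableOn_of_bounded (M := K) (hDfin k).1 hg (ae_of_all _ fun ξ => ?_)
    have := (hgG ξ).trans (mul_le_mul_of_nonneg_left (hG1 ξ) hK)
    rwa [mul_one] at this
  rw [Lp.toTemperedDistribution_apply]
  have : ∫ x, φ x • (F k : E → ℂ) x = ∫ x, φ x • 𝓕⁻ ((D k).indicator g) x := by
    refine integral_congr_ae ?_
    filter_upwards [(hpc k).1.coeFn_toLp] with x hx
    simp only [F, hx]
  rw [this, integral_mul_fourierInv hgi, ← integral_indicator (hDm k)]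
  congr with ξ
  by_cases h : ξ ∈ D k <;> simp [h]

end Fourier

section Box

open FourierTransform

/-! ### Fourier transforms of indicators of boxes -/

/-- Geometric interpolation, with weights `δ` and `1 - δ`, between the trivial bound by the length
`h` and the bound `2/(1+|t|)` from integrating the exponential. The factor `h^δ` later becomes the
Hölder modulus. -/
theorem norm_integral_cexp_le {a b t h δ : ℝ} (hab : |b - a| ≤ h) (h1 : h ≤ 1) (hδ0 : 0 ≤ δ)
    (hδ1 : δ ≤ 1) :
    ‖∫ v in a..b, Complex.exp ((↑(-2 * Real.pi * t) * Complex.I) * v)‖ ≤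
      h ^ δ * (2 * (1 + |t|) ^ (-(1 - δ))) := by
  obtain ⟨N, hN⟩ : ∃ N : ℝ,
    N = ‖∫ v in a..b, Complex.exp ((↑(-2 * Real.pi * t) * Complex.I) * v)‖ := ⟨_, rfl⟩
  rw [← hN]
  have hN0 : 0 ≤ N := hN ▸ norm_nonneg _
  have hh0 : 0 ≤ h := (abs_nonneg _).trans hab
  have hE : ∀ v : ℝ, ‖Complex.exp ((↑(-2 * Real.pi * t) * Complex.I) * v)‖ = 1 := fun v => by
    rw [show (↑(-2 * Real.pi * t) * Complex.I) * (v : ℂ) =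
      ((-2 * Real.pi * t * v : ℝ) : ℂ) * Complex.I by push_cast; ring]
    exact Complex.norm_exp_ofReal_mul_I _
  have hNh : N ≤ h := by
    rw [hN, ← one_mul h]
    exact (intervalIntegral.norm_integral_le_of_norm_le_const fun v _ => (hE v).le).trans
      (mul_le_mul_of_nonneg_left hab zero_le_one)
  have hNt : N * |t| ≤ 1 := by
    rcases eq_or_ne t 0 with rfl | ht
    · simp
    have hc : (↑(-2 * Real.pi * t) * Complex.I) ≠ 0 := by
      simp [Real.pi_ne_zero, ht]
    rw [hN, integral_exp_mul_complex hc, norm_div]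
    have hc' : ‖(↑(-2 * Real.pi * t) * Complex.I)‖ = 2 * Real.pi * |t| := by
      rw [norm_mul, Complex.norm_I, mul_one, Complex.norm_real, Real.norm_eq_abs, abs_mul, abs_mul,
        abs_of_pos Real.pi_pos]
      norm_num
    have hnum := norm_sub_le (Complex.exp ((↑(-2 * Real.pi * t) * Complex.I) * b))
      (Complex.exp ((↑(-2 * Real.pi * t) * Complex.I) * a))
    rw [hE, hE] at hnum
    rw [hc']
    have ht' : 0 < |t| := abs_pos.2 ht
    rw [div_mul_eq_mul_div, div_le_one (by positivity)]
    nlinarith [Real.pi_gt_three]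
  have hN2 : N ≤ 2 / (1 + |t|) := by
    rw [le_div_iff₀ (by positivity)]; nlinarith
  calc N = N ^ δ * N ^ (1 - δ) := by
        rw [← Real.rpow_add_of_nonneg hN0 hδ0 (by linarith)]; simp
    _ ≤ h ^ δ * (2 / (1 + |t|)) ^ (1 - δ) := by
        gcongr
    _ ≤ h ^ δ * (2 * (1 + |t|) ^ (-(1 - δ))) := by
        rw [Real.div_rpow (by norm_num) (by positivity), Real.rpow_neg (by positivity),
          div_eq_mul_inv]
        gcongr
        calc (2 : ℝ) ^ (1 - δ) ≤ 2 ^ (1 : ℝ) :=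
              Real.rpow_le_rpow_of_exponent_le (by norm_num) (by linarith)
          _ = 2 := Real.rpow_one 2

/-- Exchange one factor at a time; each exchange costs `ε` relative to the product of the bounds. -/
theorem norm_prod_sub_prod_le_of_le {ι : Type*} (s : Finset ι) {a b : ι → ℂ} {m : ι → ℝ} {ε : ℝ}
    (ha : ∀ i, ‖a i‖ ≤ m i) (hb : ∀ i, ‖b i‖ ≤ m i) (hab : ∀ i, ‖a i - b i‖ ≤ ε * m i) :
    ‖∏ i ∈ s, a i - ∏ i ∈ s, b i‖ ≤ s.card * ε * ∏ i ∈ s, m i := by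
  classical
  have hm : ∀ i, 0 ≤ m i := fun i => (norm_nonneg _).trans (ha i)
  induction s using Finset.induction_on with
  | empty => simp
  | insert j s hj ih =>
    rw [Finset.prod_insert hj, Finset.prod_insert hj, Finset.prod_insert hj,
      Finset.card_insert_of_notMem hj]
    have hbs : ‖∏ i ∈ s, b i‖ ≤ ∏ i ∈ s, m i := by
      rw [norm_prod]
      exact Finset.prod_le_prod (fun _ _ => norm_nonneg _) fun i _ => hb i
    calc ‖a j * ∏ i ∈ s, a i - b j * ∏ i ∈ s, b i‖
        = ‖a j * (∏ i ∈ s, a i - ∏ i ∈ s, b i) + (a j - b j) * ∏ i ∈ s, b i‖ := by ring_nf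
      _ ≤ m j * (s.card * ε * ∏ i ∈ s, m i) + (ε * m j) * ∏ i ∈ s, m i := by
          refine (norm_add_le _ _).trans (add_le_add ?_ ?_)
          · rw [norm_mul]
            exact mul_le_mul (ha j) ih (norm_nonneg _) (hm j)
          · rw [norm_mul]
            exact mul_le_mul (hab j) hbs (norm_nonneg _) ((norm_nonneg _).trans (hab j))
      _ = _ := by push_cast; ring

variable {d : ℕ}

/-- The box `[y, 1] = {x | y_i ≤ x_i ≤ 1 for all i}`. -/
def upperBox (y : EuclideanSpace ℝ (Fin d)) : Set (EuclideanSpace ℝ (Fin d)) :=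
  {x | ∀ i, x i ∈ Icc (y i) 1}

theorem upperBox_eq_preimage (y : EuclideanSpace ℝ (Fin d)) :
    upperBox y = (MeasurableEquiv.toLp 2 (Fin d → ℝ)).symm ⁻¹' (Icc (fun i => y i) 1) := by
  ext x
  simp only [upperBox, mem_ofPred_eq, mem_preimage, mem_Icc, Pi.le_def, forall_and]
  rfl

theorem measurableSet_upperBox (y : EuclideanSpace ℝ (Fin d)) : MeasurableSet (upperBox y) := by
  rw [upperBox_eq_preimage]
  exact (MeasurableEquiv.toLp 2 (Fin d → ℝ)).symm.measurable measurableSet_Icc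

theorem volume_upperBox_lt_top (y : EuclideanSpace ℝ (Fin d)) : volume (upperBox y) < ∞ := by
  rw [upperBox_eq_preimage, (EuclideanSpace.volume_preserving_symm_measurableEquiv_toLp
    (Fin d)).measure_preimage measurableSet_Icc.nullMeasurableSet]
  exact isCompact_Icc.measure_lt_top

/-- The indicator function of the box `[y, 1]`. -/
def boxFun (y : EuclideanSpace ℝ (Fin d)) : EuclideanSpace ℝ (Fin d) → ℂ :=
  (upperBox y).indicator 1

theorem memLp_boxFun (y : EuclideanSpace ℝ (Fin d)) (p : ℝ≥0∞) : MemLp (boxFun y) p volume :=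
  memLp_indicator_const p (measurableSet_upperBox y) (1 : ℂ) (Or.inr (volume_upperBox_lt_top y).ne)

theorem fourier_boxFun (y ξ : EuclideanSpace ℝ (Fin d)) (hy : ∀ i, y i ≤ 1) :
    𝓕 (boxFun y) ξ =
      ∏ i, ∫ v in (y i)..1, Complex.exp ((↑(-2 * Real.pi * ξ i) * Complex.I) * v) := by
  rw [Real.fourier_eq']
  have h1 : ∀ v : EuclideanSpace ℝ (Fin d),
      Complex.exp (↑(-2 * Real.pi * inner ℝ v ξ) * Complex.I) • boxFun y v =
      (fun w : Fin d → ℝ => ∏ i, (Icc (y i) 1).indicator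
        (fun v : ℝ => Complex.exp ((↑(-2 * Real.pi * ξ i) * Complex.I) * v)) (w i))
        ((MeasurableEquiv.toLp 2 (Fin d → ℝ)).symm v) := by
    intro v
    by_cases hv : v ∈ upperBox y
    · have hv' : ∀ i, ((MeasurableEquiv.toLp 2 (Fin d → ℝ)).symm v) i ∈ Icc (y i) 1 := hv
      simp only [boxFun, hv, indicator_of_mem, hv', Pi.one_apply, smul_eq_mul, mul_one]
      rw [← Complex.exp_sum]
      congr 1
      rw [PiLp.inner_apply]
      push_cast
      rw [Finset.mul_sum, Finset.sum_mul]
      refine Finset.sum_congr rfl fun i _ => ?_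
      simp
      ring
    · obtain ⟨i, hi⟩ : ∃ i, ((MeasurableEquiv.toLp 2 (Fin d → ℝ)).symm v) i ∉ Icc (y i) 1 := by
        exact not_forall.1 hv
      simp only [boxFun, hv, not_false_eq_true, indicator_of_notMem, smul_zero]
      rw [Finset.prod_eq_zero (Finset.mem_univ i)]
      exact indicator_of_notMem hi _
  rw [integral_congr_ae (ae_of_all _ h1),
    (EuclideanSpace.volume_preserving_symm_measurableEquiv_toLp (Fin d)).integral_comp'
      (g := fun w : Fin d → ℝ => ∏ i, (Icc (y i) 1).indicator
        (fun v : ℝ => Complex.exp ((↑(-2 * Real.pi * ξ i) * Complex.I) * v)) (w i)),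
    integral_fintype_prod_volume_eq_prod (fun i : Fin d => (Icc (y i) 1).indicator
        (fun v : ℝ => Complex.exp ((↑(-2 * Real.pi * ξ i) * Complex.I) * v)))]
  refine Finset.prod_congr rfl fun i _ => ?_
  rw [integral_indicator measurableSet_Icc, integral_Icc_eq_integral_Ioc,
    intervalIntegral.integral_of_le (hy i)]

theorem norm_fourier_boxFun_le {y ξ : EuclideanSpace ℝ (Fin d)} (hy : y ∈ unitCube d) {δ : ℝ}
    (hδ0 : 0 ≤ δ) (hδ1 : δ ≤ 1) :
    ‖𝓕 (boxFun y) ξ‖ ≤ ∏ i, (2 * (1 + |ξ i|) ^ (-(1 - δ))) := by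
  rw [fourier_boxFun y ξ fun i => (hy i).2, norm_prod]
  refine Finset.prod_le_prod (fun _ _ => norm_nonneg _) fun i _ => ?_
  have := norm_integral_cexp_le (a := y i) (b := 1) (t := ξ i) (h := 1)
    (abs_le.2 ⟨by linarith [(hy i).2], by linarith [(hy i).1]⟩) le_rfl hδ0 hδ1
  simpa using this

theorem norm_fourier_boxFun_sub_le {y y' ξ : EuclideanSpace ℝ (Fin d)} (hy : y ∈ unitCube d)
    (hy' : y' ∈ unitCube d) {δ h : ℝ} (hδ0 : 0 ≤ δ) (hδ1 : δ ≤ 1) (h1 : h ≤ 1)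
    (hyy : ∀ i, |y i - y' i| ≤ h) :
    ‖𝓕 (boxFun y) ξ - 𝓕 (boxFun y') ξ‖ ≤
      d * h ^ δ * ∏ i, (2 * (1 + |ξ i|) ^ (-(1 - δ))) := by
  have key : ∀ z ∈ unitCube d, ∀ i, ‖∫ v in (z i)..1,
      Complex.exp ((↑(-2 * Real.pi * ξ i) * Complex.I) * v)‖ ≤ 2 * (1 + |ξ i|) ^ (-(1 - δ)) := by
    intro z hz i
    have := norm_integral_cexp_le (a := z i) (b := 1) (t := ξ i) (h := 1)
      (abs_le.2 ⟨by linarith [(hz i).2], by linarith [(hz i).1]⟩) le_rfl hδ0 hδ1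
    simpa using this
  rw [fourier_boxFun y ξ fun i => (hy i).2, fourier_boxFun y' ξ fun i => (hy' i).2]
  have := norm_prod_sub_prod_le_of_le Finset.univ (ε := h ^ δ) (key y hy) (key y' hy') (by
    intro i
    have hint : ∀ a b : ℝ, IntervalIntegrable
        (fun v : ℝ => Complex.exp ((↑(-2 * Real.pi * ξ i) * Complex.I) * v)) volume a b :=
      fun a b => (by fun_prop : Continuous _).intervalIntegrable _ _
    rw [intervalIntegral.integral_interval_sub_interval_comm (hint _ _) (hint _ _) (hint _ _),
      intervalIntegral.integral_same, sub_zero]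
    refine norm_integral_cexp_le ?_ h1 hδ0 hδ1
    rw [abs_sub_comm]
    exact hyy i)
  simpa using this

/-- Since `1 + ‖ξ‖² ≤ ∏ (1+|ξ_i|)²`, the isotropic weight is dominated by a product weight, and the
estimates split into coordinates. -/
theorem one_add_norm_sq_rpow_le (ξ : EuclideanSpace ℝ (Fin d)) {s σ : ℝ} (hs : s ≤ σ) (hσ : 0 ≤ σ) :
    (1 + ‖ξ‖ ^ 2) ^ (s / 2) ≤ ∏ i, (1 + |ξ i|) ^ σ := by
  have h1 : 1 + ‖ξ‖ ^ 2 ≤ ∏ i, (1 + |ξ i|) ^ 2 := by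
    rw [EuclideanSpace.norm_sq_eq]
    have : ∀ t : Finset (Fin d), 1 + ∑ i ∈ t, ‖ξ i‖ ^ 2 ≤ ∏ i ∈ t, (1 + |ξ i|) ^ 2 := by
      intro t
      induction t using Finset.induction_on with
      | empty => simp
      | insert j t hj ih =>
        rw [Finset.sum_insert hj, Finset.prod_insert hj, Real.norm_eq_abs]
        have h0 : (1 : ℝ) ≤ ∏ i ∈ t, (1 + |ξ i|) ^ 2 :=
          le_trans (by simpa using Finset.sum_nonneg fun i _ => sq_nonneg ‖ξ i‖) ih
        have := abs_nonneg (ξ j)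
        nlinarith [mul_nonneg this (by linarith : (0 : ℝ) ≤ ∏ i ∈ t, (1 + |ξ i|) ^ 2),
          sq_nonneg |ξ j|]
    exact this _
  have h0 : (1 : ℝ) ≤ 1 + ‖ξ‖ ^ 2 := by nlinarith [sq_nonneg ‖ξ‖]
  calc (1 + ‖ξ‖ ^ 2) ^ (s / 2) ≤ (1 + ‖ξ‖ ^ 2) ^ (σ / 2) :=
        Real.rpow_le_rpow_of_exponent_le h0 (by linarith)
    _ ≤ (∏ i, (1 + |ξ i|) ^ 2) ^ (σ / 2) := Real.rpow_le_rpow (by linarith) h1 (by linarith)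
    _ = ∏ i, (1 + |ξ i|) ^ σ := by
        rw [← Real.finsetProd_rpow _ _ fun i _ => by positivity]
        refine Finset.prod_congr rfl fun i _ => ?_
        rw [← Real.rpow_natCast, ← Real.rpow_mul (by positivity)]
        congr 1
        push_cast; ring

theorem integrable_prod_one_add_abs_rpow {r : ℝ} (hr : 1 < r) :
    Integrable fun ξ : EuclideanSpace ℝ (Fin d) => ∏ i, (1 + |ξ i|) ^ (-r) := by
  have h1 : Integrable fun t : ℝ => (1 + |t|) ^ (-r) := by
    have := integrable_one_add_norm (E := ℝ) (μ := volume) (r := r) (by simpa using hr)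
    simpa using this
  have h2 : Integrable fun w : Fin d → ℝ => ∏ i, (1 + |w i|) ^ (-r) :=
    Integrable.fintype_prod (fun _ => h1)
  exact (EuclideanSpace.volume_preserving_symm_measurableEquiv_toLp
    (Fin d)).integrable_comp_of_integrable h2

/-! ### From product decay of the Fourier transform to `H^s_p` -/

variable {s : ℝ} {p : ℝ≥0∞} [Fact (1 ≤ p)]

theorem Sobolev.toLpFun_eq {u : Sobolev d s p}
    {f : Lp ℂ p (volume : Measure (EuclideanSpace ℝ (Fin d)))}
    (h : besselPotential (EuclideanSpace ℝ (Fin d)) ℂ s u.toDistribution =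
      Lp.toTemperedDistribution f) : u.toLpFun = f :=
  Sobolev.toTemperedDistribution_injective ((Sobolev.besselPotential_eq u).symm.trans h)

theorem exists_sobolev_of_besselPotential_eq {T : 𝓢'(EuclideanSpace ℝ (Fin d), ℂ)}
    {f : Lp ℂ p (volume : Measure (EuclideanSpace ℝ (Fin d)))}
    (h : besselPotential (EuclideanSpace ℝ (Fin d)) ℂ s T = Lp.toTemperedDistribution f) :
    ∃ w : Sobolev d s p, w.toDistribution = T ∧ ‖w‖ = ‖f‖ :=
  ⟨⟨T, f, h⟩, rfl, by rw [Sobolev.norm_eq, Sobolev.toLpFun_eq h]⟩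

/-- The Bessel potential of an integrable function, computed on the Fourier side. -/
theorem besselPotential_toLp_apply {u : EuclideanSpace ℝ (Fin d) → ℂ} (hui : Integrable u)
    (hu : MemLp u p volume) (s : ℝ) (φ : 𝓢(EuclideanSpace ℝ (Fin d), ℂ)) :
    besselPotential (EuclideanSpace ℝ (Fin d)) ℂ s (Lp.toTemperedDistribution hu.toLp) φ =
      ∫ ξ, (𝓕⁻ φ) ξ • ((((1 + ‖ξ‖ ^ 2) ^ (s / 2) : ℝ) : ℂ) * 𝓕 u ξ) := by
  rw [besselPotential, fourierMultiplierCLM_apply_apply, Lp.toTemperedDistribution_apply]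
  obtain ⟨ψ, hψ⟩ : ∃ ψ : 𝓢(EuclideanSpace ℝ (Fin d), ℂ), ψ = SchwartzMap.smulLeftCLM ℂ
    (fun x : EuclideanSpace ℝ (Fin d) => (((1 + ‖x‖ ^ 2) ^ (s / 2) : ℝ) : ℂ)) (𝓕⁻ φ) := ⟨_, rfl⟩
  rw [← hψ]
  have h1 : ∫ x, (𝓕 ψ) x • (hu.toLp u) x = ∫ x, (𝓕 ψ) x • u x := by
    refine integral_congr_ae ?_
    filter_upwards [hu.coeFn_toLp] with x hx
    rw [hx]
  rw [h1, ← integral_mul_fourier hui]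
  refine integral_congr_ae (ae_of_all _ fun ξ => ?_)
  have : ψ ξ = (((1 + ‖ξ‖ ^ 2) ^ (s / 2) : ℝ) : ℂ) * (𝓕⁻ φ) ξ := by
    rw [hψ, SchwartzMap.smulLeftCLM_apply_apply (by fun_prop), smul_eq_mul]
  simp only [this, smul_eq_mul]
  ring

/-- A function whose weighted Fourier transform is dominated by a suitable product function
belongs to `H^s_p`. -/
theorem exists_sobolev_of_fourier_le (hp : 2 ≤ p) (hp_top : p ≠ ∞) {β : ℝ}
    (hβ : 1 - 1 / p.toReal < β) (s : ℝ) :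
    ∃ C : ℝ, 0 ≤ C ∧ ∀ (K : ℝ) (u : EuclideanSpace ℝ (Fin d) → ℂ), 0 ≤ K → Integrable u →
      ∀ hu : MemLp u p volume,
      (∀ ξ, (1 + ‖ξ‖ ^ 2) ^ (s / 2) * ‖𝓕 u ξ‖ ≤ K * ∏ i, (1 + |ξ i|) ^ (-β)) →
      ∃ w : Sobolev d s p, w.toDistribution = Lp.toTemperedDistribution hu.toLp ∧ ‖w‖ ≤ C * K := by
  have hq : 2 ≤ p.toReal := by simpa using ENNReal.toReal_mono hp_top hp
  obtain ⟨κ, hκ⟩ : ∃ κ : ℝ, κ = 1 - 1 / p.toReal := ⟨_, rfl⟩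
  have hκ0 : 0 < κ := by
    rw [hκ, sub_pos, div_lt_one (by linarith)]; linarith
  rw [← hκ] at hβ
  have hβ0 : 0 < β := hκ0.trans hβ
  -- The reciprocal of the midpoint of `κ` and `β`: `rβ > 1` makes `G^r` integrable, while `rκ < 1`
  -- is what `exists_fourierInv_mem_Lp` requires.
  obtain ⟨r, hr⟩ : ∃ r : ℝ, r = 2 / (β + κ) := ⟨_, rfl⟩
  have hr0 : 0 < r := by rw [hr]; positivity
  have hr1 : 1 < β * r := by
    rw [hr, ← mul_div_assoc, one_lt_div (by positivity)]; linarith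
  have hr2 : r * κ < 1 := by
    rw [hr, div_mul_eq_mul_div, div_lt_one (by positivity)]; linarith
  let G : EuclideanSpace ℝ (Fin d) → ℝ := fun ξ => ∏ i, (1 + |ξ i|) ^ (-β)
  have hGc : Continuous G := by
    refine continuous_finsetProd _ fun i _ => Continuous.rpow_const (by fun_prop) fun ξ => ?_
    left; positivity
  have hG0 : ∀ ξ, 0 < G ξ := fun ξ => Finset.prod_pos fun i _ => by positivity
  have hG1 : ∀ ξ, G ξ ≤ 1 := fun ξ => Finset.prod_le_one (fun i _ => by positivity) fun i _ =>
    Real.rpow_le_one_of_one_le_of_nonpos (by linarith [abs_nonneg (ξ i)]) (by linarith)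
  have hGr : Integrable fun ξ => G ξ ^ r := by
    refine (integrable_prod_one_add_abs_rpow (d := d) hr1).congr (ae_of_all _ fun ξ => ?_)
    simp only [G]
    rw [← Real.finsetProd_rpow _ _ fun i _ => by positivity]
    refine Finset.prod_congr rfl fun i _ => ?_
    rw [← Real.rpow_mul (by positivity)]
    congr 1; ring
  obtain ⟨C, hC, H⟩ := exists_fourierInv_mem_Lp hp hp_top hGc.measurable hG0 hG1 hr0 hGr
    (by rwa [← hκ])
  refine ⟨C, hC, fun K u hK hui hu hb => ?_⟩
  have hw : Continuous fun ξ : EuclideanSpace ℝ (Fin d) => (1 + ‖ξ‖ ^ 2) ^ (s / 2) :=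
    Continuous.rpow_const (by fun_prop) fun ξ => Or.inl (by positivity)
  have hFu : Continuous (𝓕 u) := VectorFourier.fourierIntegral_continuous
    Real.continuous_fourierChar (L := innerₗ (EuclideanSpace ℝ (Fin d))) continuous_inner hui
  obtain ⟨f, hf, hfφ⟩ := H K (fun ξ => (((1 + ‖ξ‖ ^ 2) ^ (s / 2) : ℝ) : ℂ) * 𝓕 u ξ) hK
    ((Complex.continuous_ofReal.comp hw).mul hFu).aestronglyMeasurable (fun ξ => by
      rw [norm_mul, Complex.norm_real, Real.norm_of_nonneg (by positivity)]
      exact hb ξ)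
  have hEq : besselPotential (EuclideanSpace ℝ (Fin d)) ℂ s (Lp.toTemperedDistribution hu.toLp) =
      Lp.toTemperedDistribution f := by
    ext φ
    rw [hfφ, besselPotential_toLp_apply hui]
  obtain ⟨w, hw, hwf⟩ := exists_sobolev_of_besselPotential_eq hEq
  exact ⟨w, hw, hwf.trans_le hf⟩

/-- The indicators `1_{[y, 1]}` as elements of `H^s_p`, `s < 1 / p`: they depend Hölder
continuously on `y`. -/
theorem exists_boxVec (d : ℕ) (hp : 2 ≤ p) (hp_top : p ≠ ∞) (hs : s < 1 / p.toReal) :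
    ∃ (v : unitCube d → Sobolev d s p) (C δ : ℝ), 0 ≤ C ∧ 0 < δ ∧
      (∀ y, (v y).toDistribution = Lp.toTemperedDistribution (memLp_boxFun y.1 p).toLp) ∧
      ∀ (y y' : unitCube d) (h : ℝ), 0 ≤ h → h ≤ 1 → (∀ i, |y.1 i - y'.1 i| ≤ h) →
        ‖v y - v y'‖ ≤ C * h ^ δ := by
  have hq : 2 ≤ p.toReal := by simpa using ENNReal.toReal_mono hp_top hp
  have hq' : 1 / p.toReal ≤ 1 / 2 := one_div_le_one_div_of_le (by norm_num) hq
  have hq0 : 0 < 1 / p.toReal := by positivity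
  -- Replacing `s` by `max s 0` makes the exponent of the product weight nonnegative.
  obtain ⟨σ, hσ0, hσs, hσp⟩ : ∃ σ : ℝ, 0 ≤ σ ∧ s ≤ σ ∧ σ < 1 / p.toReal :=
    ⟨max s 0, le_max_right _ _, le_max_left _ _, max_lt hs hq0⟩
  -- Half of the gap goes to the Hölder exponent; the other half keeps the remaining decay `1 - δ -
  -- σ` above `1 - 1/p`.
  obtain ⟨δ, hδ⟩ : ∃ δ : ℝ, δ = (1 / p.toReal - σ) / 2 := ⟨_, rfl⟩
  have hδ0 : 0 < δ := by rw [hδ]; linarith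
  have hδ1 : δ ≤ 1 := by rw [hδ]; linarith
  obtain ⟨C, hC, H⟩ := exists_sobolev_of_fourier_le (d := d) hp hp_top
    (β := 1 - δ - σ) (by rw [hδ]; linarith) s
  have hprod : ∀ ξ : EuclideanSpace ℝ (Fin d), (1 + ‖ξ‖ ^ 2) ^ (s / 2) *
      ∏ i, (2 * (1 + |ξ i|) ^ (-(1 - δ))) ≤ 2 ^ d * ∏ i, (1 + |ξ i|) ^ (-(1 - δ - σ)) := by
    intro ξ
    refine (mul_le_mul_of_nonneg_right (one_add_norm_sq_rpow_le ξ hσs hσ0)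
      (Finset.prod_nonneg fun i _ => by positivity)).trans_eq ?_
    rw [Finset.prod_mul_distrib, Finset.prod_const, Finset.card_univ, Fintype.card_fin,
      mul_left_comm, ← Finset.prod_mul_distrib]
    congr 1
    refine Finset.prod_congr rfl fun i _ => ?_
    rw [← Real.rpow_add (by positivity)]
    congr 1; ring
  have hv : ∀ y : unitCube d, ∃ w : Sobolev d s p,
      w.toDistribution = Lp.toTemperedDistribution (memLp_boxFun y.1 p).toLp := by
    intro y
    obtain ⟨w, hw, -⟩ := H (2 ^ d) (boxFun y.1) (by positivity)
      (memLp_one_iff_integrable.1 (memLp_boxFun y.1 1)) (memLp_boxFun y.1 p) (fun ξ =>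
        (mul_le_mul_of_nonneg_left (norm_fourier_boxFun_le y.2 hδ0.le hδ1) (by positivity)).trans
          (hprod ξ))
    exact ⟨w, hw⟩
  choose v hv using hv
  refine ⟨v, C * (d * 2 ^ d), δ, by positivity, hδ0, hv, fun y y' h h0 h1 hyy => ?_⟩
  have hi := fun y : unitCube d => memLp_one_iff_integrable.1 (memLp_boxFun y.1 1)
  obtain ⟨w, hw, hw'⟩ := H (d * h ^ δ * 2 ^ d) (boxFun y.1 - boxFun y'.1) (by positivity)
    ((hi y).sub (hi y')) ((memLp_boxFun y.1 p).sub (memLp_boxFun y'.1 p)) (fun ξ => by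
      have e : 𝓕 (boxFun y.1 - boxFun y'.1) ξ = 𝓕 (boxFun y.1) ξ - 𝓕 (boxFun y'.1) ξ := by
        simp only [Real.fourier_eq, Pi.sub_apply, smul_sub]
        exact integral_sub ((Real.fourierIntegral_convergent_iff ξ).2 (hi y))
          ((Real.fourierIntegral_convergent_iff ξ).2 (hi y'))
      rw [e]
      calc (1 + ‖ξ‖ ^ 2) ^ (s / 2) * ‖𝓕 (boxFun y.1) ξ - 𝓕 (boxFun y'.1) ξ‖
          ≤ (1 + ‖ξ‖ ^ 2) ^ (s / 2) * (d * h ^ δ * ∏ i, (2 * (1 + |ξ i|) ^ (-(1 - δ)))) :=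
            mul_le_mul_of_nonneg_left
              (norm_fourier_boxFun_sub_le y.2 y'.2 hδ0.le hδ1 h1 hyy) (by positivity)
        _ = d * h ^ δ * ((1 + ‖ξ‖ ^ 2) ^ (s / 2) * ∏ i, (2 * (1 + |ξ i|) ^ (-(1 - δ)))) := by ring
        _ ≤ d * h ^ δ * (2 ^ d * ∏ i, (1 + |ξ i|) ^ (-(1 - δ - σ))) :=
            mul_le_mul_of_nonneg_left (hprod ξ) (by positivity)
        _ = _ := by ring)
  have hwv : w = v y - v y' := by
    apply Sobolev.toDistribution_injective
    change w.toDistribution = (v y).toDistribution - (v y').toDistribution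
    rw [hw, hv, hv, MemLp.toLp_sub, ← Lp.toTemperedDistributionCLM_apply, map_sub]
    rfl
  rw [← hwv]
  exact hw'.trans_eq (by ring)

end Box

section TwoSmooth

open scoped NNReal

/-! ### Two-smooth norms -/

/-- The norm of `B` is `2`-smooth with constant `K`. -/
def IsTwoSmooth (B : Type*) [NormedAddCommGroup B] (K : ℝ≥0) : Prop :=
  ∀ x y : B, ‖x + y‖ₑ ^ (2 : ℝ) + ‖x - y‖ₑ ^ (2 : ℝ) ≤ 2 * (‖x‖ₑ ^ (2 : ℝ) + K * ‖y‖ₑ ^ (2 : ℝ))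

/-- From `1 + z ≤ e^z` and `cosh x ≤ e^(x²/2)`, the left side is at most `2 (e^(qz²/2))^q`; since
`|z| ≤ 1`, the inner exponential is at most linear in `z²`. -/
theorem one_add_rpow_add_one_sub_rpow_le {q z : ℝ} (hq : 1 ≤ q) (hz : |z| ≤ 1) :
    (1 + z) ^ q + (1 - z) ^ q ≤ 2 * (1 + q / 2 * Real.exp (q / 2) * z ^ 2) ^ q := by
  obtain ⟨hz1, hz2⟩ := abs_le.1 hz
  have hz3 : z ^ 2 ≤ 1 := by nlinarith
  have key : ∀ w : ℝ, 0 ≤ 1 + w → (1 + w) ^ q ≤ Real.exp (q * w) := fun w hw => by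
    rw [mul_comm, Real.exp_mul]
    exact Real.rpow_le_rpow hw (by linarith [Real.add_one_le_exp w]) (by linarith)
  have h1 := key z (by linarith)
  have h2 := key (-z) (by linarith)
  have h3 := Real.cosh_le_exp_half_sq (q * z)
  rw [Real.cosh_eq] at h3
  have h4 : Real.exp (q / 2 * z ^ 2) ≤ 1 + q / 2 * Real.exp (q / 2) * z ^ 2 := by
    have h5 := Real.add_one_le_exp (-(q / 2 * z ^ 2))
    have h6 : Real.exp (-(q / 2 * z ^ 2)) * Real.exp (q / 2 * z ^ 2) = 1 := by
      rw [← Real.exp_add]; simp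
    have h7 : Real.exp (q / 2 * z ^ 2) ≤ Real.exp (q / 2) :=
      Real.exp_le_exp.2 (by nlinarith)
    have h8 := Real.exp_pos (q / 2 * z ^ 2)
    have h9 : 0 ≤ q / 2 * z ^ 2 := by positivity
    nlinarith [mul_le_mul_of_nonneg_left h7 h9, mul_le_mul_of_nonneg_right h5 h8.le]
  have h5 : Real.exp ((q * z) ^ 2 / 2) = Real.exp (q / 2 * z ^ 2) ^ q := by
    rw [← Real.exp_mul]; congr 1; ring
  have h6 := Real.rpow_le_rpow (Real.exp_pos _).le h4 (by linarith : 0 ≤ q)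
  rw [← h5] at h6
  have e1 : (1 + -z) ^ q = (1 - z) ^ q := by rw [← sub_eq_add_neg]
  have e2 : q * -z = -(q * z) := by ring
  rw [e1, e2] at h2
  linarith

/-- The pointwise form of 2-smoothness in `L^(2q)`. Writing `‖a ± b‖² = u ± w` with `u = ‖a‖² +
‖b‖²` reduces it to the preceding inequality at `z = w/u`. -/
theorem norm_add_rpow_add_norm_sub_rpow_le {q : ℝ} (hq : 1 ≤ q) (a b : ℂ) :
    ‖a + b‖ ^ (2 * q) + ‖a - b‖ ^ (2 * q) ≤
      2 * (‖a‖ ^ 2 + (1 + 2 * q * Real.exp (q / 2)) * ‖b‖ ^ 2) ^ q := by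
  obtain ⟨c, hc⟩ : ∃ c : ℝ, c = q / 2 * Real.exp (q / 2) := ⟨_, rfl⟩
  have hc0 : 0 ≤ c := by rw [hc]; positivity
  have hc' : 2 * q * Real.exp (q / 2) = 4 * c := by rw [hc]; ring
  rw [hc']
  obtain ⟨w, hw⟩ : ∃ w : ℝ, w = 2 * inner ℝ a b := ⟨_, rfl⟩
  obtain ⟨u, hu⟩ : ∃ u : ℝ, u = ‖a‖ ^ 2 + ‖b‖ ^ 2 := ⟨_, rfl⟩
  have ha : ‖a + b‖ ^ (2 * q) = (u + w) ^ q := by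
    rw [Real.rpow_mul (norm_nonneg _)]
    norm_cast
    rw [@norm_add_sq_real ℂ, hu, hw]; ring_nf
  have hb : ‖a - b‖ ^ (2 * q) = (u - w) ^ q := by
    rw [Real.rpow_mul (norm_nonneg _)]
    norm_cast
    rw [@norm_sub_sq_real ℂ, hu, hw]; ring_nf
  have hin := abs_real_inner_le_norm a b
  have hwab : |w| ≤ 2 * (‖a‖ * ‖b‖) := by
    rw [hw, abs_mul, abs_two]; linarith
  have hwu : |w| ≤ u := hwab.trans (by rw [hu]; nlinarith [sq_nonneg (‖a‖ - ‖b‖)])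
  rcases (show 0 ≤ u by rw [hu]; positivity).eq_or_lt with h0 | h0
  · have hw0 : w = 0 := by
      rw [← h0] at hwu; exact abs_nonpos_iff.1 hwu
    rw [ha, hb, ← h0, hw0, add_zero, sub_zero, Real.zero_rpow (by linarith), add_zero]
    positivity
  have hz : |w / u| ≤ 1 := by
    rw [abs_div, abs_of_pos h0]; exact div_le_one_of_le₀ hwu h0.le
  have hmain := one_add_rpow_add_one_sub_rpow_le hq hz
  rw [← hc] at hmain
  obtain ⟨hz1, hz2⟩ := abs_le.1 hz
  have e1 : (u + w) ^ q = u ^ q * (1 + w / u) ^ q := by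
    rw [← Real.mul_rpow h0.le (by linarith)]; congr 1; field_simp
  have e2 : (u - w) ^ q = u ^ q * (1 - w / u) ^ q := by
    rw [← Real.mul_rpow h0.le (by linarith)]; congr 1; field_simp
  rw [ha, hb, e1, e2, ← mul_add]
  refine (mul_le_mul_of_nonneg_left hmain (by positivity)).trans ?_
  rw [mul_left_comm, ← Real.mul_rpow h0.le (by positivity)]
  have hfin : u * (1 + c * (w / u) ^ 2) ≤ ‖a‖ ^ 2 + (1 + 4 * c) * ‖b‖ ^ 2 := by
    have e3 : u * (1 + c * (w / u) ^ 2) = u + c * (w ^ 2 / u) := by field_simp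
    -- By Cauchy–Schwarz `w² ≤ 4‖a‖²‖b‖²`, and `‖a‖² ≤ u`.
    have h5 : w ^ 2 / u ≤ 4 * ‖b‖ ^ 2 := by
      rw [div_le_iff₀ h0]
      have : w ^ 2 ≤ (2 * (‖a‖ * ‖b‖)) ^ 2 :=
        sq_le_sq' (by linarith [neg_abs_le w]) (by linarith [le_abs_self w])
      rw [hu]
      nlinarith [sq_nonneg (‖b‖ ^ 2)]
    rw [e3]
    nlinarith [mul_le_mul_of_nonneg_left h5 hc0]
  gcongr

/-- The norm of `L^p`, `2 ≤ p < ∞`, is `2`-smooth. -/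
theorem isTwoSmooth_Lp {X : Type*} [MeasurableSpace X] (μ : Measure X) {p : ℝ≥0∞} [Fact (1 ≤ p)]
    (hp : 2 ≤ p) (hp_top : p ≠ ∞) : ∃ K : ℝ≥0, IsTwoSmooth (Lp ℂ p μ) K := by
  have hp2 : 2 ≤ p.toReal := by simpa using ENNReal.toReal_mono hp_top hp
  obtain ⟨q, hq⟩ : ∃ q : ℝ, q = p.toReal / 2 := ⟨_, rfl⟩
  have hq1 : 1 ≤ q := by rw [hq]; linarith
  have hq0 : 0 < q := by linarith
  have hpq : p.toReal = 2 * q := by rw [hq]; ring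
  obtain ⟨K, hK⟩ : ∃ K : ℝ≥0, (K : ℝ) = 1 + 2 * q * Real.exp (q / 2) :=
    ⟨⟨1 + 2 * q * Real.exp (q / 2), by positivity⟩, rfl⟩
  refine ⟨K, fun x y => ?_⟩
  have hnorm : ∀ f : Lp ℂ p μ, ‖f‖ₑ = (∫⁻ a, ‖f a‖ₑ ^ (2 * q) ∂μ) ^ (1 / (2 * q)) := fun f => by
    rw [Lp.enorm_def, eLpNorm_eq_lintegral_rpow_enorm_toReal (by positivity) hp_top, hpq]
  have hnorm2 : ∀ f : Lp ℂ p μ, ‖f‖ₑ ^ (2 : ℝ) = (∫⁻ a, (‖f a‖ₑ ^ (2 : ℝ)) ^ q ∂μ) ^ (1 / q) :=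
    fun f => by
      rw [hnorm, ← ENNReal.rpow_mul]
      simp_rw [← ENNReal.rpow_mul]
      congr 1; field_simp
  have hpow : ∀ f : Lp ℂ p μ, (‖f‖ₑ ^ (2 : ℝ)) ^ q = ∫⁻ a, ‖f a‖ₑ ^ (2 * q) ∂μ := fun f => by
    rw [hnorm, ← ENNReal.rpow_mul, ← ENNReal.rpow_mul, show 1 / (2 * q) * (2 * q) = 1 by field_simp,
      ENNReal.rpow_one]
  have hpt : ∀ a b : ℂ, ‖a + b‖ₑ ^ (2 * q) + ‖a - b‖ₑ ^ (2 * q) ≤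
      2 * (‖a‖ₑ ^ (2 : ℝ) + K * ‖b‖ₑ ^ (2 : ℝ)) ^ q := by
    intro a b
    have h := norm_add_rpow_add_norm_sub_rpow_le hq1 a b
    rw [← hK] at h
    have hK' : (K : ℝ≥0∞) = ENNReal.ofReal K := (ENNReal.ofReal_coe_nnreal).symm
    simp only [← ofReal_norm, hK']
    rw [ENNReal.ofReal_rpow_of_nonneg (norm_nonneg _) (by positivity),
      ENNReal.ofReal_rpow_of_nonneg (norm_nonneg _) (by positivity),
      ENNReal.ofReal_rpow_of_nonneg (norm_nonneg _) (by positivity),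
      ENNReal.ofReal_rpow_of_nonneg (norm_nonneg _) (by positivity),
      ← ENNReal.ofReal_add (by positivity) (by positivity), ← ENNReal.ofReal_mul (by positivity),
      ← ENNReal.ofReal_add (by positivity) (by positivity),
      ENNReal.ofReal_rpow_of_nonneg (by positivity) (by positivity),
      show (2 : ℝ≥0∞) = ENNReal.ofReal 2 by simp, ← ENNReal.ofReal_mul (by positivity)]
    refine ENNReal.ofReal_le_ofReal ?_
    simpa using h
  have hmx : AEMeasurable (fun a => ‖x a‖ₑ ^ (2 : ℝ)) μ :=
    (Lp.aestronglyMeasurable x).enorm.pow_const _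
  have hmy : AEMeasurable (fun a => (K : ℝ≥0∞) * ‖y a‖ₑ ^ (2 : ℝ)) μ :=
    ((Lp.aestronglyMeasurable y).enorm.pow_const _).const_mul _
  obtain ⟨H, hH⟩ : ∃ H : ℝ≥0∞, H =
      (∫⁻ a, (‖x a‖ₑ ^ (2 : ℝ) + K * ‖y a‖ₑ ^ (2 : ℝ)) ^ q ∂μ) ^ (1 / q) :=
    ⟨_, rfl⟩
  -- Minkowski's inequality in `L^q`, `q = p/2 ≥ 1`, for the functions `|x|²` and `K|y|²`.
  have hMink : H ≤ ‖x‖ₑ ^ (2 : ℝ) + K * ‖y‖ₑ ^ (2 : ℝ) := by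
    rw [hH, hnorm2 x, hnorm2 y]
    refine (ENNReal.lintegral_Lp_add_le hmx hmy hq1).trans_eq ?_
    congr 1
    simp_rw [ENNReal.mul_rpow_of_nonneg _ _ hq0.le]
    rw [lintegral_const_mul'' _ (((Lp.aestronglyMeasurable y).enorm.pow_const _).pow_const _),
      ENNReal.mul_rpow_of_nonneg _ _ (by positivity), ← ENNReal.rpow_mul, mul_one_div_cancel hq0.ne',
      ENNReal.rpow_one]
  have hHq : H ^ q = ∫⁻ a, (‖x a‖ₑ ^ (2 : ℝ) + K * ‖y a‖ₑ ^ (2 : ℝ)) ^ q ∂μ := by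
    rw [hH, ← ENNReal.rpow_mul, one_div_mul_cancel hq0.ne', ENNReal.rpow_one]
  have hsum : (‖x + y‖ₑ ^ (2 : ℝ)) ^ q + (‖x - y‖ₑ ^ (2 : ℝ)) ^ q ≤ 2 * H ^ q := by
    rw [hpow, hpow, hHq, ← lintegral_add_left' ((Lp.aestronglyMeasurable _).enorm.pow_const _),
      ← lintegral_const_mul' _ _ (by norm_num)]
    refine lintegral_mono_ae ?_
    filter_upwards [Lp.coeFn_add x y, Lp.coeFn_sub x y] with a h1 h2
    rw [h1, h2]
    exact hpt _ _
  -- Convexity of the `q`-th power costs `2^(q-1)`; with the factor 2 in `hsum` this is exactly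
  -- `2^q`, so taking `q`-th roots leaves the factor 2 of the definition.
  have h3 := ENNReal.rpow_add_le_mul_rpow_add_rpow (‖x + y‖ₑ ^ (2 : ℝ)) (‖x - y‖ₑ ^ (2 : ℝ)) hq1
  have h4 : (‖x + y‖ₑ ^ (2 : ℝ) + ‖x - y‖ₑ ^ (2 : ℝ)) ^ q ≤ (2 * H) ^ q := by
    refine h3.trans ((mul_le_mul_right hsum _).trans_eq ?_)
    rw [ENNReal.mul_rpow_of_nonneg _ _ hq0.le, ← mul_assoc]
    congr 1
    nth_rewrite 2 [← ENNReal.rpow_one 2]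
    rw [← ENNReal.rpow_add _ _ (by norm_num) (by norm_num)]
    congr 1; ring
  exact ((ENNReal.rpow_le_rpow_iff hq0).1 h4).trans (mul_le_mul_right hMink _)

theorem IsTwoSmooth.of_norm_map {B B' : Type*} [NormedAddCommGroup B] [NormedAddCommGroup B']
    {K : ℝ≥0} (hK : IsTwoSmooth B' K) (f : B →+ B') (hf : ∀ x, ‖f x‖ = ‖x‖) : IsTwoSmooth B K := by
  have hf' : ∀ x, ‖f x‖ₑ = ‖x‖ₑ := fun x => by rw [← ofReal_norm, hf, ofReal_norm]
  intro x y
  have := hK (f x) (f y)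
  rwa [← map_add, ← map_sub, hf', hf', hf', hf'] at this

theorem isTwoSmooth_real : IsTwoSmooth ℝ 1 := by
  intro x y
  have hE : ∀ z : ℝ, ‖z‖ₑ ^ (2 : ℝ) = ENNReal.ofReal (z ^ 2) := fun z => by
    rw [← ofReal_norm, ENNReal.ofReal_rpow_of_nonneg (norm_nonneg _) (by norm_num)]
    norm_num
  rw [hE, hE, hE, hE, ENNReal.coe_one, one_mul, ← ENNReal.ofReal_add (by positivity) (by positivity),
    ← ENNReal.ofReal_add (by positivity) (by positivity), show (2 : ℝ≥0∞) = ENNReal.ofReal 2 by simp,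
    ← ENNReal.ofReal_mul (by positivity)]
  exact ENNReal.ofReal_le_ofReal (by nlinarith)

end TwoSmooth

section StableSums

open scoped NNReal

/-! ### Sums of independent symmetric random variables in two-smooth spaces -/

variable {Ω : Type*} [MeasurableSpace Ω] {P : Measure Ω} {ι : Type*}
  {B : Type*} [NormedAddCommGroup B] [NormedSpace ℝ B]

theorem measurable_enorm_sum_smul (s : Finset ι) (F : ι → B) [Fintype ι] :
    Measurable fun x : ι → ℝ => ‖∑ i ∈ s, x i • F i‖ₑ :=
  (by fun_prop : Continuous fun x : ι → ℝ => ‖∑ i ∈ s, x i • F i‖ₑ).measurable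

/-- Induction on the number of summands: by symmetry and independence, flipping the sign of the new
summand preserves the joint law, so the second moment is the average over both signs, to which
2-smoothness applies. -/
theorem lintegral_enorm_sum_sq_le [IsProbabilityMeasure P] [Fintype ι] {K : ℝ≥0}
    (hB : IsTwoSmooth B K)
    {ξ : ι → Ω → ℝ} (hm : ∀ i, Measurable (ξ i)) (hind : iIndepFun ξ P)
    (hsym : ∀ i, P.map (fun ω => -ξ i ω) = P.map (ξ i)) (F : ι → B) (s : Finset ι) :
    ∫⁻ ω, ‖∑ i ∈ s, ξ i ω • F i‖ₑ ^ (2 : ℝ) ∂P ≤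
      K * ∑ i ∈ s, ‖F i‖ₑ ^ (2 : ℝ) * ∫⁻ ω, ‖ξ i ω‖ₑ ^ (2 : ℝ) ∂P := by
  classical
  have hξ : Measurable fun ω i => ξ i ω := measurable_pi_lambda _ hm
  induction s using Finset.induction_on with
  | empty => simp
  | insert j s hj ih =>
    let η : ι → Ω → ℝ := fun i => if i = j then fun ω => -ξ i ω else ξ i
    have hηm : ∀ i, Measurable (η i) := fun i => by
      by_cases h : i = j
      · simp only [η, h, if_true]
        exact (hm j).neg
      · simpa [η, h] using hm i
    have hηind : iIndepFun η P := by
      have := hind.comp (fun i => if i = j then fun x : ℝ => -x else id) fun i => by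
        by_cases h : i = j
        · simpa [h] using measurable_neg
        · simpa [h] using measurable_id
      convert this using 2 with i
      by_cases h : i = j
      · simp only [η, h, if_true]; rfl
      · simp only [η, h, if_false]; rfl
    have hlaw : P.map (fun ω i => η i ω) = P.map (fun ω i => ξ i ω) := by
      rw [(iIndepFun_iff_map_fun_eq_pi_map fun i => (hm i).aemeasurable).1 hind,
        (iIndepFun_iff_map_fun_eq_pi_map fun i => (hηm i).aemeasurable).1 hηind]
      congr 1
      ext1 i
      by_cases h : i = j
      · simp only [η, h, if_true]; exact hsym j
      · simp only [η, h, if_false]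
    have hmeas : ∀ t : Finset ι, Measurable fun x : ι → ℝ => ‖∑ i ∈ t, x i • F i‖ₑ ^ (2 : ℝ) :=
      fun t => (measurable_enorm_sum_smul t F).pow_const _
    have hflip : ∫⁻ ω, ‖∑ i ∈ insert j s, η i ω • F i‖ₑ ^ (2 : ℝ) ∂P =
        ∫⁻ ω, ‖∑ i ∈ insert j s, ξ i ω • F i‖ₑ ^ (2 : ℝ) ∂P := by
      rw [← lintegral_map (hmeas (insert j s)) (measurable_pi_lambda _ hηm), hlaw,
        lintegral_map (hmeas (insert j s)) hξ]
    have h1 : ∀ ω, ∑ i ∈ insert j s, ξ i ω • F i = ∑ i ∈ s, ξ i ω • F i + ξ j ω • F j := fun ω => by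
      rw [Finset.sum_insert hj, add_comm]
    have h2 : ∀ ω, ∑ i ∈ insert j s, η i ω • F i = ∑ i ∈ s, ξ i ω • F i - ξ j ω • F j := fun ω => by
      rw [Finset.sum_insert hj, add_comm, sub_eq_add_neg]
      congr 1
      · refine Finset.sum_congr rfl fun i hi => ?_
        have : i ≠ j := fun h => hj (h ▸ hi)
        simp only [η, this, if_false]
      · simp [η]
    have h3 : 2 * ∫⁻ ω, ‖∑ i ∈ insert j s, ξ i ω • F i‖ₑ ^ (2 : ℝ) ∂P ≤
        2 * (∫⁻ ω, ‖∑ i ∈ s, ξ i ω • F i‖ₑ ^ (2 : ℝ) ∂P +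
          K * (‖F j‖ₑ ^ (2 : ℝ) * ∫⁻ ω, ‖ξ j ω‖ₑ ^ (2 : ℝ) ∂P)) := by
      rw [two_mul]
      nth_rewrite 2 [← hflip]
      rw [← lintegral_add_left (show Measurable fun ω => ‖∑ i ∈ insert j s, ξ i ω • F i‖ₑ ^ (2 : ℝ) from
          (hmeas (insert j s)).comp hξ), ← mul_assoc,
        ← lintegral_const_mul _ ((hm j).enorm.pow_const _), 
        ← lintegral_add_left (show Measurable fun ω => ‖∑ i ∈ s, ξ i ω • F i‖ₑ ^ (2 : ℝ) from
          (hmeas s).comp hξ),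
        ← lintegral_const_mul' _ _ (by norm_num)]
      refine lintegral_mono fun ω => ?_
      rw [h1, h2]
      refine (hB _ _).trans_eq ?_
      rw [enorm_smul, ENNReal.mul_rpow_of_nonneg _ _ (by norm_num), mul_assoc,
        mul_comm (‖ξ j ω‖ₑ ^ (2 : ℝ))]
    rw [ENNReal.mul_le_mul_iff_right (by norm_num) (by norm_num)] at h3
    refine h3.trans ?_
    rw [Finset.sum_insert hj, mul_add, add_comm]
    gcongr

/-! ### Tail estimates for stable laws -/

theorem measurableSet_abs_le (r : ℝ) : MeasurableSet {x : ℝ | |x| ≤ r} :=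
  measurableSet_le (f := fun x : ℝ => |x|) measurable_id.abs measurable_const

theorem measurableSet_lt_abs (r : ℝ) : MeasurableSet {x : ℝ | r < |x|} :=
  measurableSet_lt (g := fun x : ℝ => |x|) measurable_const measurable_id.abs

theorem IsSymStable.map_neg {α σ : ℝ} {μ : Measure ℝ} [IsProbabilityMeasure μ]
    (h : IsSymStable α σ μ) : μ.map (fun x => -x) = μ := by
  have : IsProbabilityMeasure (μ.map fun x => -x) :=
    Measure.isProbabilityMeasure_map measurable_neg.aemeasurable
  refine Measure.ext_of_charFun (funext fun t => ?_)
  have e : charFun (μ.map fun x => -x) t = charFun μ (-t) := by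
    rw [charFun_apply_real, charFun_apply_real, integral_map measurable_neg.aemeasurable
      (by fun_prop)]
    congr with x
    push_cast; ring_nf
  rw [e, h, h, abs_neg]

theorem IsSymStable.norm_one_sub_charFun_le {α m : ℝ} (hα : 0 < α) (hm : 0 ≤ m) {μ : Measure ℝ}
    (h : IsSymStable α (m ^ (1 / α)) μ) (t : ℝ) : ‖1 - charFun μ t‖ ≤ m * |t| ^ α := by
  rw [h t, ← Real.rpow_mul hm, one_div_mul_cancel hα.ne', Real.rpow_one]
  have h0 : 0 ≤ m * |t| ^ α := by positivity
  rw [← Complex.ofReal_neg, ← Complex.ofReal_exp, ← Complex.ofReal_one, ← Complex.ofReal_sub,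
    Complex.norm_real, Real.norm_eq_abs, abs_of_nonneg]
  · linarith [Real.add_one_le_exp (-(m * |t| ^ α))]
  · rw [sub_nonneg, Real.exp_le_one_iff]; linarith

/-- The tail is controlled by the average of `1 - charFun μ` near the origin. With scale `m^(1/α)`,
this quantity is at most `m|t|^α`, hence the linear dependence on `m`. -/
theorem IsSymStable.measureReal_gt_le {α m : ℝ} (hα : 0 < α) (hm : 0 ≤ m) {μ : Measure ℝ}
    [IsProbabilityMeasure μ] (h : IsSymStable α (m ^ (1 / α)) μ) {r : ℝ} (hr : 0 < r) :
    μ.real {x | r < |x|} ≤ 2 * 2 ^ α * (m * r ^ (-α)) := by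
  refine (measureReal_abs_gt_le_integral_charFun hr).trans ?_
  have h1 : ‖∫ t in (-2 * r⁻¹)..(2 * r⁻¹), 1 - charFun μ t‖ ≤
      (m * (2 * r⁻¹) ^ α) * |2 * r⁻¹ - -2 * r⁻¹| := by
    refine intervalIntegral.norm_integral_le_of_norm_le_const fun t ht => ?_
    refine (h.norm_one_sub_charFun_le hα hm t).trans ?_
    have hr' : 0 < r⁻¹ := inv_pos.2 hr
    rw [uIoc_of_le (by linarith)] at ht
    have : |t| ≤ 2 * r⁻¹ := abs_le.2 ⟨by linarith [ht.1], ht.2⟩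
    gcongr
  have h2 : |2 * r⁻¹ - -2 * r⁻¹| = 4 * r⁻¹ := by
    rw [abs_of_nonneg (by ring_nf; positivity)]; ring
  rw [h2, Real.mul_rpow (by norm_num) (by positivity), Real.inv_rpow hr.le, ← Real.rpow_neg hr.le] at h1
  calc 2⁻¹ * r * ‖∫ t in (-2 * r⁻¹)..(2 * r⁻¹), 1 - charFun μ t‖
      ≤ 2⁻¹ * r * (m * (2 ^ α * r ^ (-α)) * (4 * r⁻¹)) := by gcongr
    _ = 2 * 2 ^ α * (m * r ^ (-α)) * (r * r⁻¹) := by ring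
    _ = _ := by rw [mul_inv_cancel₀ hr.ne', mul_one]

/-- For `|x| ≤ r`, `x²` is at most `(π²/2) r² (1 - cos(x/r))`, and the integral of `1 - cos(x/r)` is
the real part of `1 - charFun μ r⁻¹`. -/
theorem IsSymStable.lintegral_sq_le {α m : ℝ} (hα : 0 < α) (hm : 0 ≤ m) {μ : Measure ℝ}
    [IsProbabilityMeasure μ] (h : IsSymStable α (m ^ (1 / α)) μ) {r : ℝ} (hr : 0 < r) :
    ∫⁻ x in {x | |x| ≤ r}, ‖x‖ₑ ^ (2 : ℝ) ∂μ ≤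
      ENNReal.ofReal (Real.pi ^ 2 / 2 * (m * r ^ (2 - α))) := by
  have hint : Integrable (fun x : ℝ => Complex.exp (((r⁻¹ * x : ℝ) : ℂ) * Complex.I)) μ := by
    refine Integrable.of_bound (C := 1) (by fun_prop) (ae_of_all _ fun x => ?_)
    rw [Complex.norm_exp_ofReal_mul_I]
  have hcosint : Integrable (fun x : ℝ => 1 - Real.cos (r⁻¹ * x)) μ := by
    refine (integrable_const 1).sub (Integrable.of_bound (C := 1) (by fun_prop)
      (ae_of_all _ fun x => ?_))
    exact Real.abs_cos_le_one _
  have hcos : ∫ x, (1 - Real.cos (r⁻¹ * x)) ∂μ = (1 - charFun μ r⁻¹).re := by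
    have e : (1 - charFun μ r⁻¹) = ∫ x : ℝ, (1 - Complex.exp (((r⁻¹ * x : ℝ) : ℂ) * Complex.I)) ∂μ := by
      rw [integral_sub (integrable_const _) hint, charFun_apply_real]
      simp
    rw [e, ← RCLike.re_eq_complex_re, ← integral_re (show Integrable
      (fun x : ℝ => 1 - Complex.exp (((r⁻¹ * x : ℝ) : ℂ) * Complex.I)) μ
      from (integrable_const _).sub hint)]
    refine integral_congr_ae (ae_of_all _ fun x => ?_)
    simp only [RCLike.re_eq_complex_re, Complex.sub_re, Complex.one_re, Complex.exp_ofReal_mul_I_re]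
  have hle : ∫ x, (1 - Real.cos (r⁻¹ * x)) ∂μ ≤ m * r ^ (-α) := by
    rw [hcos]
    refine (Complex.re_le_norm _).trans ((h.norm_one_sub_charFun_le hα hm _).trans_eq ?_)
    rw [abs_of_pos (inv_pos.2 hr), Real.inv_rpow hr.le, ← Real.rpow_neg hr.le]
  have hms := measurableSet_abs_le r
  calc ∫⁻ x in {x | |x| ≤ r}, ‖x‖ₑ ^ (2 : ℝ) ∂μ
      ≤ ∫⁻ x, ENNReal.ofReal (Real.pi ^ 2 / 2 * r ^ 2 * (1 - Real.cos (r⁻¹ * x))) ∂μ := by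
        rw [← lintegral_indicator hms]
        refine lintegral_mono fun x => ?_
        by_cases hx : |x| ≤ r
        · rw [indicator_of_mem (by exact hx), ← ofReal_norm,
            ENNReal.ofReal_rpow_of_nonneg (norm_nonneg _) (by norm_num)]
          refine ENNReal.ofReal_le_ofReal ?_
          have hx1 : |r⁻¹ * x| ≤ Real.pi := by
            rw [abs_mul, abs_of_pos (inv_pos.2 hr), inv_mul_le_iff₀ hr]
            nlinarith [Real.pi_gt_three]
          have hc := Real.cos_le_one_sub_mul_cos_sq hx1
          have e : x ^ 2 = r ^ 2 * (r⁻¹ * x) ^ 2 := by field_simp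
          have e2 : ‖x‖ ^ (2 : ℝ) = x ^ 2 := by norm_num
          have e3 : 2 / Real.pi ^ 2 * (r⁻¹ * x) ^ 2 ≤ 1 - Real.cos (r⁻¹ * x) := by linarith
          rw [e2, e]
          calc r ^ 2 * (r⁻¹ * x) ^ 2
              = Real.pi ^ 2 / 2 * r ^ 2 * (2 / Real.pi ^ 2 * (r⁻¹ * x) ^ 2) := by
                field_simp
            _ ≤ _ := by gcongr
        · rw [indicator_of_notMem (by exact hx)]
          exact zero_le
    _ = ENNReal.ofReal (∫ x, Real.pi ^ 2 / 2 * r ^ 2 * (1 - Real.cos (r⁻¹ * x)) ∂μ) := by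
        rw [ofReal_integral_eq_lintegral_ofReal (hcosint.const_mul _) (ae_of_all _ fun x => ?_)]
        have := Real.cos_le_one (r⁻¹ * x)
        have h1 : 0 ≤ 1 - Real.cos (r⁻¹ * x) := by linarith
        dsimp only [Pi.zero_apply]
        positivity
    _ ≤ _ := by
        rw [integral_const_mul]
        refine ENNReal.ofReal_le_ofReal ?_
        calc Real.pi ^ 2 / 2 * r ^ 2 * ∫ x, (1 - Real.cos (r⁻¹ * x)) ∂μ
            ≤ Real.pi ^ 2 / 2 * r ^ 2 * (m * r ^ (-α)) := by gcongr
          _ = Real.pi ^ 2 / 2 * (m * (r ^ (2 : ℝ) * r ^ (-α))) := by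
              rw [Real.rpow_two]; ring
          _ = _ := by rw [← Real.rpow_add hr]; ring_nf

/-- The weak-type estimate for sums `∑ X_i F_i` with independent symmetric `α`-stable coefficients
in a two-smooth space. -/
theorem measureReal_norm_sum_gt_le [IsProbabilityMeasure P] [Fintype ι] {K : ℝ≥0}
    (hB : IsTwoSmooth B K) {α : ℝ} (hα : 0 < α) {X : ι → Ω → ℝ} (hX : ∀ i, Measurable (X i))
    (hind : iIndepFun X P) {m : ι → ℝ} (hm : ∀ i, 0 ≤ m i)
    (hlaw : ∀ i, IsSymStable α (m i ^ (1 / α)) (P.map (X i))) (F : ι → B) {t : ℝ} (ht : 0 < t) :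
    P.real {ω | t < ‖∑ i, X i ω • F i‖} ≤
      (2 * 2 ^ α + K * (Real.pi ^ 2 / 2)) * (t ^ (-α) * ∑ i, ‖F i‖ ^ α * m i) := by
  classical
  have hprob : ∀ i, IsProbabilityMeasure (P.map (X i)) := fun i =>
    Measure.isProbabilityMeasure_map (hX i).aemeasurable
  -- Each coefficient is cut off where its own summand exceeds `t` in norm. The cut-off is odd, so
  -- symmetry survives, and the truncated coefficients have finite second moments.
  let T : ι → ℝ → ℝ := fun i => {x | ‖F i‖ * |x| ≤ t}.indicator id
  have hTs : ∀ i, MeasurableSet {x : ℝ | ‖F i‖ * |x| ≤ t} := fun i =>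
    measurableSet_le (measurable_const.mul measurable_id.abs) measurable_const
  have hT : ∀ i, Measurable (T i) := fun i => measurable_id.indicator (hTs i)
  have hTneg : ∀ i x, -T i x = T i (-x) := fun i x => by
    by_cases h : ‖F i‖ * |x| ≤ t
    · simp [T, h]
    · simp [T, h]
  let ξ : ι → Ω → ℝ := fun i ω => T i (X i ω)
  have hξm : ∀ i, Measurable (ξ i) := fun i => (hT i).comp (hX i)
  have hξ : iIndepFun ξ P := hind.comp T hT
  have hsym : ∀ i, P.map (fun ω => -ξ i ω) = P.map (ξ i) := fun i => by
    have e1 : (fun ω => -ξ i ω) = T i ∘ (fun x => -x) ∘ X i := by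
      ext ω; simp [ξ, hTneg]
    rw [e1, ← Measure.map_map (hT i) (measurable_neg.comp (hX i)),
      ← Measure.map_map measurable_neg (hX i), (hlaw i).map_neg, Measure.map_map (hT i) (hX i)]
    rfl
  have hmom := lintegral_enorm_sum_sq_le hB hξm hξ hsym F Finset.univ
  -- Either some single summand exceeds `t`, which the stable tails control, or nothing is truncated
  -- and Chebyshev's inequality applies.
  have hsub : {ω | t < ‖∑ i, X i ω • F i‖} ⊆
      (⋃ i, {ω | t < ‖F i‖ * |X i ω|}) ∪ {ω | t ≤ ‖∑ i, ξ i ω • F i‖} := by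
    intro ω hω
    by_cases h : ∃ i, t < ‖F i‖ * |X i ω|
    · exact Or.inl (mem_iUnion.2 h)
    · right
      push Not at h
      have : ∀ i, ξ i ω = X i ω := fun i => indicator_of_mem (by exact h i) _
      simp only [mem_ofPred_eq, this]
      exact le_of_lt hω
  have hpt : ∀ i, P.real {ω | t < ‖F i‖ * |X i ω|} ≤
      2 * 2 ^ α * (t ^ (-α) * (‖F i‖ ^ α * m i)) := by
    intro i
    rcases (norm_nonneg (F i)).eq_or_lt with h0 | h0
    · have : {ω | t < ‖F i‖ * |X i ω|} = ∅ := by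
        ext ω; simp [← h0, ht.le]
      rw [this, measureReal_empty]
      have := hm i
      positivity
    · have e : {ω | t < ‖F i‖ * |X i ω|} = X i ⁻¹' {x | t / ‖F i‖ < |x|} := by
        ext ω
        simp only [mem_ofPred_eq, mem_preimage]
        rw [div_lt_iff₀' h0]
      have h1 := (hlaw i).measureReal_gt_le hα (hm i) (r := t / ‖F i‖) (by positivity)
      rw [map_measureReal_apply (hX i) (measurableSet_lt_abs _),
        ← e] at h1
      refine h1.trans_eq ?_
      rw [Real.div_rpow ht.le h0.le, Real.rpow_neg h0.le, div_inv_eq_mul]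
      ring
  have hsec : ∀ i, ‖F i‖ₑ ^ (2 : ℝ) * ∫⁻ ω, ‖ξ i ω‖ₑ ^ (2 : ℝ) ∂P ≤
      ENNReal.ofReal (Real.pi ^ 2 / 2 * (t ^ (2 - α) * (‖F i‖ ^ α * m i))) := by
    intro i
    rcases (norm_nonneg (F i)).eq_or_lt with h0 | h0
    · have : F i = 0 := norm_eq_zero.1 h0.symm
      simp [this]
    · have e : ∫⁻ ω, ‖ξ i ω‖ₑ ^ (2 : ℝ) ∂P =
          ∫⁻ x in {x | |x| ≤ t / ‖F i‖}, ‖x‖ₑ ^ (2 : ℝ) ∂(P.map (X i)) := by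
        rw [← lintegral_indicator (measurableSet_abs_le _),
          lintegral_map _ (hX i)]
        · refine lintegral_congr fun ω => ?_
          by_cases h : ‖F i‖ * |X i ω| ≤ t
          · have h' : |X i ω| ≤ t / ‖F i‖ := (le_div_iff₀' h0).2 h
            simp [ξ, T, h, h']
          · have h' : ¬ |X i ω| ≤ t / ‖F i‖ := fun h'' => h ((le_div_iff₀' h0).1 h'')
            simp [ξ, T, h, h']
        · exact (measurable_enorm.pow_const _).indicator (measurableSet_abs_le _)
      have h1 := (hlaw i).lintegral_sq_le hα (hm i) (r := t / ‖F i‖) (by positivity)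
      rw [e]
      refine (mul_le_mul_right h1 _).trans_eq ?_
      rw [← ofReal_norm, ENNReal.ofReal_rpow_of_nonneg h0.le (by norm_num),
        ← ENNReal.ofReal_mul (by positivity)]
      congr 1
      rw [Real.div_rpow ht.le h0.le, Real.rpow_sub h0]
      field_simp
  have hm0 : 0 ≤ ∑ i, ‖F i‖ ^ α * m i := Finset.sum_nonneg fun i _ => by
    have := hm i
    positivity
  have hcheb : P.real {ω | t ≤ ‖∑ i, ξ i ω • F i‖} ≤
      K * (Real.pi ^ 2 / 2) * (t ^ (-α) * ∑ i, ‖F i‖ ^ α * m i) := by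
    have hmeas : Measurable fun ω => ‖∑ i, ξ i ω • F i‖ₑ ^ (2 : ℝ) :=
      ((measurable_enorm_sum_smul Finset.univ F).pow_const _).comp (measurable_pi_lambda _ hξm)
    have h1 := meas_ge_le_lintegral_div hmeas.aemeasurable (μ := P)
      (ε := ENNReal.ofReal (t ^ (2 : ℝ))) (by positivity) ENNReal.ofReal_ne_top
    have e : {ω | ENNReal.ofReal (t ^ (2 : ℝ)) ≤ ‖∑ i, ξ i ω • F i‖ₑ ^ (2 : ℝ)} =
        {ω | t ≤ ‖∑ i, ξ i ω • F i‖} := by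
      ext ω
      simp only [mem_ofPred_eq]
      rw [← ENNReal.ofReal_rpow_of_nonneg ht.le (by norm_num),
        ENNReal.rpow_le_rpow_iff (by norm_num), ← ofReal_norm,
        ENNReal.ofReal_le_ofReal_iff (norm_nonneg _)]
    have h2 : ∫⁻ ω, ‖∑ i, ξ i ω • F i‖ₑ ^ (2 : ℝ) ∂P ≤
        ENNReal.ofReal (K * (Real.pi ^ 2 / 2 * (t ^ (2 - α) * ∑ i, ‖F i‖ ^ α * m i))) := by
      refine hmom.trans ?_
      rw [ENNReal.ofReal_mul (by positivity), ENNReal.ofReal_coe_nnreal]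
      gcongr
      refine (Finset.sum_le_sum fun i _ => hsec i).trans_eq ?_
      rw [← ENNReal.ofReal_sum_of_nonneg, Finset.mul_sum, Finset.mul_sum]
      intro i _
      have := hm i
      positivity
    rw [e] at h1
    have h3 := h1.trans (ENNReal.div_le_div_right h2 _)
    rw [← ENNReal.ofReal_div_of_pos (by positivity)] at h3
    refine (ENNReal.toReal_le_of_le_ofReal (by positivity) h3).trans_eq ?_
    have : t ^ (2 - α) = t ^ (-α) * t ^ (2 : ℝ) := by
      rw [← Real.rpow_add ht]; ring_nf
    rw [this]
    field_simp
  calc P.real {ω | t < ‖∑ i, X i ω • F i‖}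
      ≤ P.real (⋃ i, {ω | t < ‖F i‖ * |X i ω|}) + P.real {ω | t ≤ ‖∑ i, ξ i ω • F i‖} :=
        (measureReal_mono hsub).trans (measureReal_union_le _ _)
    _ ≤ ∑ i, P.real {ω | t < ‖F i‖ * |X i ω|} + P.real {ω | t ≤ ‖∑ i, ξ i ω • F i‖} := by
        gcongr
        exact measureReal_iUnion_fintype_le _
    _ ≤ ∑ i, 2 * 2 ^ α * (t ^ (-α) * (‖F i‖ ^ α * m i)) +
          K * (Real.pi ^ 2 / 2) * (t ^ (-α) * ∑ i, ‖F i‖ ^ α * m i) := by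
        gcongr with i _
        exact hpt i
    _ = _ := by
        rw [← Finset.mul_sum, ← Finset.mul_sum]; ring

end StableSums

section RandomMeasure

open scoped NNReal

/-! ### Vector-valued integrals of simple functions against stable random measures -/

variable {E Ω : Type*} [MeasurableSpace E] [MeasurableSpace Ω] {α : ℝ} {m : Measure E}
  {P : Measure Ω} {M : Set E → Ω → ℝ} {B : Type*} [NormedAddCommGroup B] [NormedSpace ℝ B]
  {β γ : Type*}

/-- The integral `∫ F(g) dM = ∑_b M({g = b}) F(b)` for a simple function `g` and an arbitrary
vector-valued function `F`. -/
def vectorIntegral (M : Set E → Ω → ℝ) (g : SimpleFunc E β) (F : β → B) : Ω → B :=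
  fun ω => ∑ b ∈ g.range, M (g ⁻¹' {b}) ω • F b

namespace IsSymStableRandomMeasure

/-- The partial sums `n · M ∅` converge, so their constant increments vanish. -/
theorem ae_empty (hM : IsSymStableRandomMeasure α m P M) : ∀ᵐ ω ∂P, M ∅ ω = 0 := by
  have h := hM.sigmaAdditive (fun _ => ∅) (fun _ => MeasurableSet.empty) (by simp)
    (fun _ _ _ => by simp) (by simp)
  filter_upwards [h] with ω hω
  simp only [iUnion_empty, Finset.sum_const, Finset.card_range, nsmul_eq_mul] at hω
  have h1 := (hω.comp (tendsto_add_atTop_nat 1)).sub hω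
  have h2 : Tendsto (fun _ : ℕ => M ∅ ω) atTop (𝓝 (M ∅ ω - M ∅ ω)) := by
    refine h1.congr fun n => ?_
    simp only [Function.comp_apply]
    push_cast; ring
  simpa using tendsto_nhds_unique tendsto_const_nhds h2

variable [IsFiniteMeasure m]

theorem ae_union (hM : IsSymStableRandomMeasure α m P M) {A A' : Set E} (hA : MeasurableSet A)
    (hA' : MeasurableSet A') (hd : Disjoint A A') :
    ∀ᵐ ω ∂P, M (A ∪ A') ω = M A ω + M A' ω := by
  let S : ℕ → Set E := fun n => if n = 0 then A else if n = 1 then A' else ∅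
  have hS : ⋃ n, S n = A ∪ A' := by
    ext x
    simp only [mem_iUnion, mem_union]
    constructor
    · rintro ⟨n, hn⟩
      by_cases h0 : n = 0
      · left; simpa [S, h0] using hn
      · by_cases h1 : n = 1
        · right; simpa [S, h1] using hn
        · simp [S, h0, h1] at hn
    · rintro (h | h)
      · exact ⟨0, by simpa [S] using h⟩
      · exact ⟨1, by simpa [S] using h⟩
  have h := hM.sigmaAdditive S (fun n => by
      by_cases h0 : n = 0
      · simpa [S, h0] using hA
      · by_cases h1 : n = 1
        · simpa [S, h1] using hA'
        · simp [S, h0, h1]) (fun n => measure_lt_top _ _) (fun i j hij => by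
      by_cases hi0 : i = 0 <;> by_cases hi1 : i = 1 <;> by_cases hj0 : j = 0 <;>
        by_cases hj1 : j = 1 <;> simp_all [S, disjoint_comm]) (measure_lt_top _ _)
  filter_upwards [h, hM.ae_empty] with ω hω h0
  rw [hS] at hω
  have hev : ∀ᶠ n in atTop, ∑ j ∈ Finset.range n, M (S j) ω = M A ω + M A' ω := by
    filter_upwards [eventually_ge_atTop 2] with n hn
    obtain ⟨k, rfl⟩ := Nat.exists_eq_add_of_le hn
    rw [Finset.sum_range_add]
    have : ∑ x ∈ Finset.range k, M (S (2 + x)) ω = 0 := by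
      refine Finset.sum_eq_zero fun j _ => ?_
      have h1 : 2 + j ≠ 0 := by omega
      have h2 : 2 + j ≠ 1 := by omega
      simp only [S, h1, h2, if_false, h0]
    rw [this, add_zero, Finset.sum_range_succ, Finset.sum_range_succ]
    simp [S]
  exact tendsto_nhds_unique hω (tendsto_const_nhds.congr' (hev.mono fun n h => h.symm))

theorem ae_biUnion (hM : IsSymStableRandomMeasure α m P M) (g : SimpleFunc E β) (s : Finset β) :
    ∀ᵐ ω ∂P, M (g ⁻¹' ↑s) ω = ∑ b ∈ s, M (g ⁻¹' {b}) ω := by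
  classical
  induction s using Finset.induction_on with
  | empty => simpa using hM.ae_empty
  | insert b s hb ih =>
    have hd : Disjoint (g ⁻¹' {b}) (g ⁻¹' ↑s) :=
      Disjoint.preimage _ (by simpa using hb)
    filter_upwards [ih, hM.ae_union (g.measurableSet_preimage _) (g.measurableSet_preimage _) hd]
      with ω h1 h2
    rw [Finset.sum_insert hb, ← h1, ← h2, ← preimage_union, Finset.coe_insert, insert_eq]

/-- Additivity of `M` makes the integral insensitive to refining the partition. This allows
integrals of two simple functions to be compared over their pairing. -/
theorem ae_vectorIntegral_map (hM : IsSymStableRandomMeasure α m P M) (g : SimpleFunc E β)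
    (h : β → γ) (F : γ → B) :
    vectorIntegral M (g.map h) F =ᵐ[P] vectorIntegral M g (F ∘ h) := by
  classical
  have key : ∀ᵐ ω ∂P, ∀ c ∈ (g.map h).range, M (g.map h ⁻¹' {c}) ω =
      ∑ b ∈ g.range.filter (fun b => h b = c), M (g ⁻¹' {b}) ω := by
    refine (Finset.eventually_all _).2 fun c _ => ?_
    simp only [SimpleFunc.map_preimage_singleton]
    exact hM.ae_biUnion g _
  filter_upwards [key] with ω hω
  simp only [vectorIntegral]
  rw [Finset.sum_congr rfl fun c hc => by rw [hω c hc, Finset.sum_smul], SimpleFunc.range_map]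
  rw [← Finset.sum_fiberwise_of_maps_to (g := h) (t := g.range.image h)
    fun b hb => Finset.mem_image_of_mem h hb]
  refine Finset.sum_congr rfl fun c _ => Finset.sum_congr rfl fun b hb => ?_
  rw [Function.comp_apply, (Finset.mem_filter.1 hb).2]

theorem ae_vectorIntegral_indicator (hM : IsSymStableRandomMeasure α m P M) (g : SimpleFunc E β)
    (S : Set β) :
    vectorIntegral M g (S.indicator (1 : β → ℝ)) =ᵐ[P] M (g ⁻¹' S) := by
  classical
  have e : g ⁻¹' S = g ⁻¹' ↑(g.range.filter (· ∈ S)) := by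
    ext x
    simp
  rw [e]
  filter_upwards [hM.ae_biUnion g (g.range.filter (· ∈ S))] with ω hω
  rw [hω, Finset.sum_filter, vectorIntegral]
  refine Finset.sum_congr rfl fun b _ => ?_
  by_cases h : b ∈ S <;> simp [h]

/-- The weak-type estimate for vector-valued integrals. -/
theorem measure_norm_vectorIntegral_gt_le [IsProbabilityMeasure P]
    (hM : IsSymStableRandomMeasure α m P M) (hα : 0 < α) {K : ℝ≥0} (hB : IsTwoSmooth B K)
    (g : SimpleFunc E β) (F : β → B) {t : ℝ} (ht : 0 < t) :
    P {ω | t < ‖vectorIntegral M g F ω‖} ≤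
      ENNReal.ofReal ((2 * 2 ^ α + K * (Real.pi ^ 2 / 2)) * t ^ (-α)) *
        ∫⁻ x, ‖F (g x)‖ₑ ^ α ∂m := by
  classical
  let e := g.range.equivFin
  let A : Fin g.range.card → Set E := fun i => g ⁻¹' {(e.symm i : β)}
  have hA : ∀ i, MeasurableSet (A i) := fun i => g.measurableSet_preimage _
  have hd : Pairwise (fun i j => Disjoint (A i) (A j)) := fun i j hij => by
    refine Disjoint.preimage _ ?_
    simpa [Subtype.ext_iff] using hij
  have hind := hM.indep _ A hA (fun i => measure_lt_top _ _) hd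
  have h1 := measureReal_norm_sum_gt_le hB hα (fun i => hM.measurable (A i) (hA i) (measure_lt_top _ _))
    hind (m := fun i => (m (A i)).toReal) (fun i => ENNReal.toReal_nonneg)
    (fun i => hM.law (A i) (hA i) (measure_lt_top _ _)) (fun i => F (e.symm i)) ht
  have h2 : ∀ ω, ∑ i, M (A i) ω • F (e.symm i) = vectorIntegral M g F ω := fun ω => by
    rw [vectorIntegral, ← Finset.sum_coe_sort g.range,
      ← Equiv.sum_comp e.symm (fun b : g.range => M (g ⁻¹' {(b : β)}) ω • F b)]
  have h3 : ∫⁻ x, ‖F (g x)‖ₑ ^ α ∂m =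
      ENNReal.ofReal (∑ i, ‖F (e.symm i)‖ ^ α * (m (A i)).toReal) := by
    have := SimpleFunc.map_lintegral (μ := m) (fun b => ‖F b‖ₑ ^ α) g
    rw [← SimpleFunc.lintegral_eq_lintegral] at this
    simp only [SimpleFunc.map_apply] at this
    rw [this, ENNReal.ofReal_sum_of_nonneg (fun i _ => by positivity), ← Finset.sum_coe_sort g.range,
      ← Equiv.sum_comp e.symm (fun b : g.range => ‖F b‖ₑ ^ α * m (g ⁻¹' {(b : β)}))]
    refine Finset.sum_congr rfl fun i _ => ?_
    rw [ENNReal.ofReal_mul (by positivity), ENNReal.ofReal_toReal (measure_ne_top _ _),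
      ← ofReal_norm, ENNReal.ofReal_rpow_of_nonneg (norm_nonneg _) hα.le]
  simp_rw [h2] at h1
  rw [h3, ← ENNReal.ofReal_mul (by positivity), mul_assoc, ← ofReal_measureReal]
  exact ENNReal.ofReal_le_ofReal h1

/-- The stochastic integral of an indicator function is the value of the random measure. -/
theorem ae_eq_of_isStochasticIntegral_indicator [IsProbabilityMeasure P]
    (hM : IsSymStableRandomMeasure α m P M) (hα : 0 < α) {A : Set E} (hA : MeasurableSet A)
    {X : Ω → ℝ} (hX : IsStochasticIntegral α m P M (A.indicator 1) X) : X =ᵐ[P] M A := by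
  classical
  obtain ⟨g, -, hg, hgX⟩ := hX
  refine tendstoInMeasure_ae_unique hgX (f := fun k => simpleIntegral M (g k)) ?_
  rw [tendstoInMeasure_iff_norm]
  intro ε hε
  -- Pairing `g k` with this indicator gives a common refinement whose second coordinate records
  -- membership in `A`.
  let a : SimpleFunc E ℝ := SimpleFunc.piecewise A hA (SimpleFunc.const E 1) (SimpleFunc.const E 0)
  have ha : ∀ x, a x = A.indicator 1 x := fun x => by
    by_cases h : x ∈ A <;> simp [a, h]
  have haA : ∀ k, (SimpleFunc.pair (g k) a) ⁻¹' {q | q.2 = 1} = A := fun k => by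
    ext x
    simp only [mem_preimage, SimpleFunc.pair_apply, mem_ofPred_eq, ha]
    by_cases h : x ∈ A <;> simp [h]
  let F : ℝ × ℝ → ℝ := fun q => q.1 - {q : ℝ × ℝ | q.2 = 1}.indicator 1 q
  have hdiff : ∀ k, ∀ᵐ ω ∂P, simpleIntegral M (g k) ω - M A ω =
      vectorIntegral M (SimpleFunc.pair (g k) a) F ω := by
    intro k
    have h1 := hM.ae_vectorIntegral_map (SimpleFunc.pair (g k) a) Prod.fst (fun y : ℝ => y)
    have h2 := hM.ae_vectorIntegral_indicator (SimpleFunc.pair (g k) a) {q | q.2 = 1}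
    rw [haA] at h2
    filter_upwards [h1, h2] with ω h1 h2
    have e1 : (SimpleFunc.pair (g k) a).map Prod.fst = g k := by ext x; simp
    have e2 : simpleIntegral M (g k) ω = vectorIntegral M (g k) (fun y : ℝ => y) ω := by
      simp only [simpleIntegral, vectorIntegral, smul_eq_mul, mul_comm]
    rw [e2, ← h2]
    rw [e1] at h1
    rw [h1]
    simp only [vectorIntegral, F, ← Finset.sum_sub_distrib, ← smul_sub]
    rfl
  have hnorm : ∀ k, ∫⁻ x, ‖F (SimpleFunc.pair (g k) a x)‖ₑ ^ α ∂m =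
      eLpNorm (fun x => A.indicator 1 x - g k x) (ENNReal.ofReal α) m ^ α := by
    intro k
    rw [eLpNorm_eq_lintegral_rpow_enorm_toReal (by simpa using hα) (by simp),
      ENNReal.toReal_ofReal hα.le, ← ENNReal.rpow_mul, one_div_mul_cancel hα.ne', ENNReal.rpow_one]
    refine lintegral_congr fun x => ?_
    congr 1
    have : F (SimpleFunc.pair (g k) a x) = g k x - A.indicator 1 x := by
      simp only [F, SimpleFunc.pair_apply]
      congr 1
      by_cases h : x ∈ A <;> simp [h, ha]
    rw [this, ← enorm_neg, neg_sub]
  obtain ⟨C, hC⟩ : ∃ C : ℝ≥0∞, C = ENNReal.ofReal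
    ((2 * 2 ^ α + (1 : ℝ≥0) * (Real.pi ^ 2 / 2)) * (ε / 2) ^ (-α)) := ⟨_, rfl⟩
  have hlim : Tendsto (fun k => C *
      eLpNorm (fun x => A.indicator 1 x - g k x) (ENNReal.ofReal α) m ^ α) atTop (𝓝 0) := by
    have h1 := ENNReal.Tendsto.const_mul (a := C) (hg.ennrpow_const α)
      (Or.inr (by rw [hC]; exact ENNReal.ofReal_ne_top))
    simpa [ENNReal.zero_rpow_of_pos hα] using h1
  refine tendsto_of_tendsto_of_tendsto_of_le_of_le tendsto_const_nhds hlim (fun _ => zero_le)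
    fun k => ?_
  -- The threshold `ε/2` passes from the event `ε ≤ ‖·‖` to the strict inequality of the weak-type
  -- bound.
  have h1 := hM.measure_norm_vectorIntegral_gt_le hα isTwoSmooth_real (SimpleFunc.pair (g k) a) F
    (half_pos hε)
  rw [hnorm, ← hC] at h1
  refine le_trans (measure_mono_ae ?_) h1
  filter_upwards [hdiff k] with ω hω h
  change ε ≤ ‖simpleIntegral M (g k) ω - M A ω‖ at h
  change ε / 2 < ‖vectorIntegral M (SimpleFunc.pair (g k) a) F ω‖
  rw [← hω]
  linarith

/-- Continuity from above of a stable random measure along a fixed sequence. -/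
theorem ae_tendsto_of_antitone (hM : IsSymStableRandomMeasure α m P M) {S : ℕ → Set E}
    (hS : ∀ n, MeasurableSet (S n)) (hanti : Antitone S) :
    ∀ᵐ ω ∂P, Tendsto (fun n => M (S n) ω) atTop (𝓝 (M (⋂ n, S n) ω)) := by
  -- The disjoint shells have measures telescoping to `M (S 0) - M (S n)`, and together with the
  -- intersection they exhaust `S 0`.
  let D : ℕ → Set E := fun n => S n \ S (n + 1)
  have hD : ∀ n, MeasurableSet (D n) := fun n => (hS n).diff (hS (n + 1))
  have hdis : ∀ i j, i < j → Disjoint (D i) (D j) := fun i j hij => by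
    rw [Set.disjoint_left]
    exact fun x hx hx' => hx.2 (hanti hij hx'.1)
  have hpair : Pairwise (fun i j => Disjoint (D i) (D j)) := fun i j hij => by
    rcases lt_or_gt_of_ne hij with h | h
    exacts [hdis i j h, (hdis j i h).symm]
  have h1 := hM.sigmaAdditive D hD (fun _ => measure_lt_top _ _) hpair (measure_lt_top _ _)
  have h2 : ∀ᵐ ω ∂P, ∀ n, M (S n) ω = M (D n) ω + M (S (n + 1)) ω := by
    refine ae_all_iff.2 fun n => ?_
    have := hM.ae_union (hD n) (hS (n + 1)) disjoint_sdiff_left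
    rwa [show D n ∪ S (n + 1) = S n from sdiff_union_of_subset (hanti n.le_succ)] at this
  have hU : (⋃ n, D n) ∪ ⋂ n, S n = S 0 := by
    ext x
    constructor
    · rintro (h | h)
      · obtain ⟨n, hn⟩ := mem_iUnion.1 h
        exact hanti n.zero_le hn.1
      · exact mem_iInter.1 h 0
    · intro h0
      by_cases h : ∀ n, x ∈ S n
      · exact Or.inr (mem_iInter.2 h)
      · left
        push Not at h
        classical
        have h' := Nat.find_spec h
        obtain ⟨k, hk⟩ : ∃ k, Nat.find h = k + 1 :=
          Nat.exists_eq_succ_of_ne_zero fun h00 => by rw [h00] at h'; exact h' h0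
        refine mem_iUnion.2 ⟨k, ?_, ?_⟩
        · have := Nat.find_min h (m := k) (by omega)
          simpa using this
        · rwa [hk] at h'
  have hdU : Disjoint (⋃ n, D n) (⋂ n, S n) := by
    rw [Set.disjoint_left]
    intro x hx hx'
    obtain ⟨n, hn⟩ := mem_iUnion.1 hx
    exact hn.2 (mem_iInter.1 hx' (n + 1))
  have h3 := hM.ae_union (MeasurableSet.iUnion hD) (MeasurableSet.iInter hS) hdU
  rw [hU] at h3
  filter_upwards [h1, h2, h3] with ω h1 h2 h3
  have h4 : ∀ n, ∑ j ∈ Finset.range n, M (D j) ω = M (S 0) ω - M (S n) ω := by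
    intro n
    induction n with
    | zero => simp
    | succ n ih => rw [Finset.sum_range_succ, ih]; linarith [h2 n]
  simp_rw [h4] at h1
  have h5 := (tendsto_const_nhds (x := M (S 0) ω)).sub h1
  simpa [h3] using h5

end IsSymStableRandomMeasure

end RandomMeasure

section Sheet

open scoped NNReal

/-! ### Dyadic discretization of the cube -/

/-- The largest multiple of `2⁻ⁿ` below `x`. -/
def dyadicFloor (n : ℕ) (x : ℝ) : ℝ := ⌊2 ^ n * x⌋₊ / 2 ^ n

theorem dyadicFloor_le {n : ℕ} {x : ℝ} (hx : 0 ≤ x) : dyadicFloor n x ≤ x := by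
  rw [dyadicFloor, div_le_iff₀ (by positivity), mul_comm x]
  exact Nat.floor_le (by positivity)

theorem sub_dyadicFloor_le (n : ℕ) (x : ℝ) : x - dyadicFloor n x ≤ 2⁻¹ ^ n := by
  have h := (Nat.lt_floor_add_one (2 ^ n * x)).le
  have h2 : (0 : ℝ) < 2 ^ n := by positivity
  rw [dyadicFloor, inv_pow, sub_le_iff_le_add, inv_eq_one_div, ← add_div, le_div_iff₀ h2]
  linarith

theorem dyadicFloor_nonneg (n : ℕ) (x : ℝ) : 0 ≤ dyadicFloor n x := by
  unfold dyadicFloor; positivity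

theorem dyadicFloor_le_succ (n : ℕ) {x : ℝ} (hx : 0 ≤ x) :
    dyadicFloor n x ≤ dyadicFloor (n + 1) x := by
  have h2 : (0 : ℝ) < 2 ^ n := by positivity
  have h1 : 2 * ⌊2 ^ n * x⌋₊ ≤ ⌊2 ^ (n + 1) * x⌋₊ := by
    refine Nat.le_floor ?_
    have := Nat.floor_le (show 0 ≤ 2 ^ n * x by positivity)
    push_cast
    rw [pow_succ]
    linarith
  have h3 : (2 : ℝ) * ⌊2 ^ n * x⌋₊ ≤ ⌊2 ^ (n + 1) * x⌋₊ := by exact_mod_cast h1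
  rw [dyadicFloor, dyadicFloor, div_le_div_iff₀ h2 (by positivity)]
  calc (⌊2 ^ n * x⌋₊ : ℝ) * 2 ^ (n + 1) = 2 * ⌊2 ^ n * x⌋₊ * 2 ^ n := by ring
    _ ≤ _ := by gcongr

theorem measurable_dyadicFloor (n : ℕ) : Measurable (dyadicFloor n) :=
  ((measurable_from_nat (f := fun k : ℕ => (k : ℝ))).comp
    (Nat.measurable_floor.comp (measurable_const_mul _))).div_const _

variable {d : ℕ}

/-- The lower corner of the dyadic cell of `x`. -/
def dyadicCorner (n : ℕ) (x : unitCube d) : unitCube d :=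
  ⟨WithLp.toLp 2 fun i => dyadicFloor n (x.1 i), fun i =>
    ⟨dyadicFloor_nonneg _ _, (dyadicFloor_le (x.2 i).1).trans (x.2 i).2⟩⟩

theorem dyadicCorner_apply (n : ℕ) (x : unitCube d) (i : Fin d) :
    (dyadicCorner n x).1 i = dyadicFloor n (x.1 i) := rfl

theorem measurable_dyadicCorner (n : ℕ) : Measurable (dyadicCorner n : unitCube d → unitCube d) := by
  refine Measurable.subtype_mk ((WithLp.measurable_toLp 2 (Fin d → ℝ)).comp
    (measurable_pi_lambda _ fun i => (measurable_dyadicFloor n).comp ?_))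
  exact (by fun_prop : Continuous fun x : unitCube d => x.1 i).measurable

theorem finite_range_dyadicCorner (n : ℕ) :
    (range (dyadicCorner n : unitCube d → unitCube d)).Finite := by
  have h : (range fun (k : Fin d → Fin (2 ^ n + 1)) =>
      (WithLp.toLp 2 fun i => ((k i : ℕ) : ℝ) / 2 ^ n : EuclideanSpace ℝ (Fin d))).Finite :=
    finite_range _
  refine Finite.of_finite_image (f := Subtype.val) (h.subset ?_) Subtype.val_injective.injOn
  rintro _ ⟨_, ⟨x, rfl⟩, rfl⟩
  refine ⟨fun i => ⟨⌊2 ^ n * x.1 i⌋₊, Nat.lt_succ_of_le ?_⟩, rfl⟩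
  refine Nat.floor_le_of_le ?_
  have := (x.2 i).2
  push_cast
  have h2 : (0 : ℝ) < 2 ^ n := by positivity
  nlinarith

/-- `dyadicCorner n` as a simple function. -/
def dyadicSimple (d n : ℕ) : SimpleFunc (unitCube d) (unitCube d) where
  toFun := dyadicCorner n
  measurableSet_fiber' y := measurable_dyadicCorner n (measurableSet_singleton y)
  finite_range' := finite_range_dyadicCorner n

theorem abs_dyadicCorner_succ_sub_le (n : ℕ) (x : unitCube d) (i : Fin d) :
    |(dyadicCorner (n + 1) x).1 i - (dyadicCorner n x).1 i| ≤ 2⁻¹ ^ n := by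
  rw [dyadicCorner_apply, dyadicCorner_apply,
    abs_of_nonneg (sub_nonneg.2 (dyadicFloor_le_succ n (x.2 i).1))]
  have h1 := sub_dyadicFloor_le n (x.1 i)
  have h2 := dyadicFloor_le (n := n + 1) (x.2 i).1
  linarith

theorem measurableSet_unitCube : MeasurableSet (unitCube d) := by
  have : unitCube d = ⋂ i, (fun x : EuclideanSpace ℝ (Fin d) => x i) ⁻¹' Icc 0 1 := by
    ext x; simp [unitCube]
  rw [this]
  exact MeasurableSet.iInter fun i =>
    (by fun_prop : Continuous fun x : EuclideanSpace ℝ (Fin d) => x i).measurable measurableSet_Icc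

instance : IsFiniteMeasure (lebesgue d) := by
  refine ⟨?_⟩
  rw [lebesgue, (MeasurableEmbedding.subtype_coe measurableSet_unitCube).comap_apply]
  refine (measure_mono ?_).trans_lt (volume_upperBox_lt_top (0 : EuclideanSpace ℝ (Fin d)))
  rintro _ ⟨x, -, rfl⟩
  exact x.2

/-! ### Convergence of the discretized sheets -/

variable {Ω : Type*} [MeasurableSpace Ω] {α : ℝ} {P : Measure Ω}
  {M : Set (unitCube d) → Ω → ℝ} {B : Type*} [NormedAddCommGroup B] [NormedSpace ℝ B]

/-- Moving to the next dyadic corner changes the integrand by at most `C 2^(-nδ)`; the weak-type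
bound and Borel–Cantelli then make the increments summable. It serves both for `H^s_p` and for
`L^p`. -/
theorem ae_cauchySeq_vectorIntegral [IsProbabilityMeasure P]
    (hM : IsSymStableRandomMeasure α (lebesgue d) P M) (hα : 0 < α)
    {K : ℝ≥0} (hB : IsTwoSmooth B K) {v : unitCube d → B} {C δ : ℝ} (hC : 0 ≤ C) (hδ : 0 < δ)
    (hv : ∀ (y y' : unitCube d) (h : ℝ), 0 ≤ h → h ≤ 1 → (∀ i, |y.1 i - y'.1 i| ≤ h) →
        ‖v y - v y'‖ ≤ C * h ^ δ) :
    ∀ᵐ ω ∂P, CauchySeq fun n => vectorIntegral M (dyadicSimple d n) v ω := by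
  -- Since `2^(-nδ) = ρ^(2n)`, one factor `ρ^n` can be spent as the threshold, and the other leaves
  -- tail probabilities of order `ρ^(αn)`.
  obtain ⟨ρ, hρ⟩ : ∃ ρ : ℝ, ρ = (2⁻¹ : ℝ) ^ (δ / 2) := ⟨_, rfl⟩
  have hρ0 : 0 < ρ := by rw [hρ]; positivity
  have hρ1 : ρ < 1 := by
    rw [hρ]; exact Real.rpow_lt_one (by norm_num) (by norm_num) (by linarith)
  have hρ2 : ∀ n : ℕ, ((2⁻¹ : ℝ) ^ n) ^ δ = ρ ^ n * ρ ^ n := fun n => by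
    rw [hρ, ← mul_pow, ← Real.rpow_add (by norm_num), add_halves, ← Real.rpow_natCast,
      ← Real.rpow_natCast, ← Real.rpow_mul (by norm_num), ← Real.rpow_mul (by norm_num), mul_comm]
  let g : ℕ → SimpleFunc (unitCube d) (unitCube d × unitCube d) := fun n =>
    SimpleFunc.pair (dyadicSimple d (n + 1)) (dyadicSimple d n)
  let F : unitCube d × unitCube d → B := fun q => v q.1 - v q.2
  have hdiff : ∀ᵐ ω ∂P, ∀ n, vectorIntegral M (dyadicSimple d (n + 1)) v ω -
      vectorIntegral M (dyadicSimple d n) v ω = vectorIntegral M (g n) F ω := by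
    refine ae_all_iff.2 fun n => ?_
    have h1 := hM.ae_vectorIntegral_map (g n) Prod.fst v
    have h2 := hM.ae_vectorIntegral_map (g n) Prod.snd v
    have e1 : (g n).map Prod.fst = dyadicSimple d (n + 1) := by ext x; simp [g]
    have e2 : (g n).map Prod.snd = dyadicSimple d n := by ext x; simp [g]
    rw [e1] at h1
    rw [e2] at h2
    filter_upwards [h1, h2] with ω h1 h2
    rw [h1, h2]
    simp only [vectorIntegral, F, ← Finset.sum_sub_distrib, ← smul_sub]
    rfl
  obtain ⟨A, hA⟩ : ∃ A : ℝ, A = 2 * 2 ^ α + K * (Real.pi ^ 2 / 2) := ⟨_, rfl⟩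
  have hA0 : 0 ≤ A := by rw [hA]; positivity
  have htail : ∀ n, P {ω | ρ ^ n < ‖vectorIntegral M (g n) F ω‖} ≤
      ENNReal.ofReal (A * C ^ α * (lebesgue d univ).toReal * (ρ ^ α) ^ n) := by
    intro n
    have hn : 0 < ρ ^ n := by positivity
    refine (hM.measure_norm_vectorIntegral_gt_le hα hB (g n) F hn).trans ?_
    rw [← hA]
    have hFx : ∀ x, ‖F (g n x)‖ₑ ^ α ≤ ENNReal.ofReal ((C * (ρ ^ n * ρ ^ n)) ^ α) := fun x => by
      rw [← ofReal_norm, ENNReal.ofReal_rpow_of_nonneg (norm_nonneg _) hα.le]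
      refine ENNReal.ofReal_le_ofReal (Real.rpow_le_rpow (norm_nonneg _) ?_ hα.le)
      rw [← hρ2]
      exact hv _ _ _ (by positivity) (pow_le_one₀ (by norm_num) (by norm_num))
        (abs_dyadicCorner_succ_sub_le n x)
    have hI : ∫⁻ x, ‖F (g n x)‖ₑ ^ α ∂(lebesgue d) ≤
        ENNReal.ofReal ((C * (ρ ^ n * ρ ^ n)) ^ α * (lebesgue d univ).toReal) := by
      refine (lintegral_mono hFx).trans_eq ?_
      rw [lintegral_const, ENNReal.ofReal_mul (by positivity),
        ENNReal.ofReal_toReal (measure_ne_top _ _)]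
    refine (mul_le_mul_right hI _).trans_eq ?_
    rw [← ENNReal.ofReal_mul (by positivity)]
    congr 1
    rw [Real.mul_rpow hC (by positivity), Real.mul_rpow hn.le hn.le, Real.rpow_neg hn.le]
    have e : (ρ ^ α) ^ n = (ρ ^ n) ^ α := by
      rw [← Real.rpow_natCast, ← Real.rpow_natCast, ← Real.rpow_mul hρ0.le, ← Real.rpow_mul hρ0.le,
        mul_comm]
    rw [e]
    field_simp
  have hsum : ∑' n, P {ω | ρ ^ n < ‖vectorIntegral M (g n) F ω‖} ≠ ∞ := by
    refine ne_top_of_le_ne_top ?_ (ENNReal.tsum_le_tsum htail)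
    have hs : Summable fun n : ℕ => A * C ^ α * (lebesgue d univ).toReal * (ρ ^ α) ^ n :=
      (summable_geometric_of_lt_one (by positivity)
        (Real.rpow_lt_one hρ0.le hρ1 hα)).mul_left _
    rw [← ENNReal.ofReal_tsum_of_nonneg (fun n => by positivity) hs]
    exact ENNReal.ofReal_ne_top
  filter_upwards [ae_eventually_notMem hsum, hdiff] with ω h1 h2
  refine cauchySeq_of_summable_dist ?_
  refine Summable.of_norm_bounded_eventually_nat (summable_geometric_of_lt_one hρ0.le hρ1) ?_
  filter_upwards [h1] with n hn
  rw [Real.norm_of_nonneg dist_nonneg, dist_comm, dist_eq_norm, h2]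
  exact not_lt.1 hn

/-- The points of the cube below `x`. -/
def lowerBox (x : unitCube d) : Set (unitCube d) := {y | ∀ i, y.1 i ≤ x.1 i}

/-- The discretized sheet. -/
def discreteSheet (M : Set (unitCube d) → Ω → ℝ) (n : ℕ) (x : unitCube d) (ω : Ω) : ℝ :=
  vectorIntegral M (dyadicSimple d n) ((lowerBox x).indicator (1 : unitCube d → ℝ)) ω

theorem measurableSet_lowerBox (x : unitCube d) : MeasurableSet (lowerBox x) := by
  have : lowerBox x = ⋂ i, {y : unitCube d | y.1 i ≤ x.1 i} := by ext; simp [lowerBox]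
  rw [this]
  exact MeasurableSet.iInter fun i => (isClosed_le (by fun_prop) (by fun_prop)).measurableSet

theorem measurable_discreteSheet (hM : IsSymStableRandomMeasure α (lebesgue d) P M) (n : ℕ) :
    Measurable (Function.uncurry (discreteSheet M n)) := by
  simp only [Function.uncurry_def, discreteSheet, vectorIntegral, smul_eq_mul]
  refine Finset.measurable_sum _ fun y _ => Measurable.mul ?_ ?_
  · exact (hM.measurable _ ((dyadicSimple d n).measurableSet_preimage _)
      (measure_lt_top _ _)).comp measurable_snd
  · have hs : MeasurableSet {x : unitCube d | ∀ i, y.1 i ≤ x.1 i} := by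
      have : {x : unitCube d | ∀ i, y.1 i ≤ x.1 i} = ⋂ i, {x : unitCube d | y.1 i ≤ x.1 i} := by
        ext; simp
      rw [this]
      exact MeasurableSet.iInter fun i => (isClosed_le (by fun_prop) (by fun_prop)).measurableSet
    exact ((measurable_one (α := ℝ)).indicator hs).comp measurable_fst

/-- The discretized sheet at `x` is `M` of the set of points whose dyadic corner lies below `x`. As
corners are rounded down and increase with `n`, these sets decrease to the box below `x`, and
continuity from above applies. -/
theorem ae_tendsto_discreteSheet [IsProbabilityMeasure P] (hα : 0 < α) {U : unitCube d → Ω → ℝ}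
    (hM : IsSymStableRandomMeasure α (lebesgue d) P M)
    (hU : ∀ x, IsStochasticIntegral α (lebesgue d) P M (sheetKernel x) (U x)) (x : unitCube d) :
    ∀ᵐ ω ∂P, Tendsto (fun n => discreteSheet M n x ω) atTop (𝓝 (U x ω)) := by
  have h1 := hM.ae_eq_of_isStochasticIntegral_indicator hα (measurableSet_lowerBox x) (hU x)
  have hanti : Antitone fun n => dyadicSimple d n ⁻¹' lowerBox x := by
    refine antitone_nat_of_succ_le fun n y hy i => ?_
    exact (dyadicFloor_le_succ n (y.2 i).1).trans (hy i)
  have h2 := hM.ae_tendsto_of_antitone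
    (fun n => (dyadicSimple d n).measurableSet_preimage (lowerBox x)) hanti
  have hI : ⋂ n, dyadicSimple d n ⁻¹' lowerBox x = lowerBox x := by
    ext y
    rw [mem_iInter]
    constructor
    · intro h i
      have hlim : Tendsto (fun n : ℕ => x.1 i + (2⁻¹ : ℝ) ^ n) atTop (𝓝 (x.1 i + 0)) :=
        tendsto_const_nhds.add (tendsto_pow_atTop_nhds_zero_of_lt_one (by norm_num) (by norm_num))
      rw [add_zero] at hlim
      refine ge_of_tendsto' hlim fun n => ?_
      have h3 : dyadicFloor n (y.1 i) ≤ x.1 i := h n i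
      linarith [sub_dyadicFloor_le n (y.1 i)]
    · intro h n i
      exact (dyadicFloor_le (y.2 i).1).trans (h i)
  rw [hI] at h2
  have h3 : ∀ᵐ ω ∂P, ∀ n, discreteSheet M n x ω = M (dyadicSimple d n ⁻¹' lowerBox x) ω :=
    ae_all_iff.2 fun n => hM.ae_vectorIntegral_indicator (dyadicSimple d n) (lowerBox x)
  filter_upwards [h1, h2, h3] with ω h1 h2 h3
  rw [h1]
  simpa only [h3] using h2

/-- A limsup is defined everywhere and jointly measurable, although the null set on which
convergence may fail depends on `x`. -/
theorem exists_measurableVersion [IsProbabilityMeasure P] (hα : 0 < α) {U : unitCube d → Ω → ℝ}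
    (hM : IsSymStableRandomMeasure α (lebesgue d) P M)
    (hU : ∀ x, IsStochasticIntegral α (lebesgue d) P M (sheetKernel x) (U x)) :
    ∃ V, IsMeasurableVersion P U V := by
  refine ⟨fun x ω => limsup (fun n => discreteSheet M n x ω) atTop,
    Measurable.limsup fun n => measurable_discreteSheet hM n, fun x => ?_⟩
  filter_upwards [ae_tendsto_discreteSheet hα hM hU x] with ω hω
  exact hω.limsup_eq

/-! ### Sample paths in Bessel potential spaces -/

variable {s : ℝ} {p : ℝ≥0∞} [Fact (1 ≤ p)]

theorem measurable_vectorIntegral [MeasurableSpace B] [BorelSpace B]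
    (hM : IsSymStableRandomMeasure α (lebesgue d) P M) {β : Type*} (g : SimpleFunc (unitCube d) β)
    (F : β → B) : Measurable (vectorIntegral M g F) := by
  have h1 : Continuous fun c : g.range → ℝ => ∑ b : g.range, c b • F b := by fun_prop
  have h2 : Measurable fun ω => fun b : g.range => M (g ⁻¹' {(b : β)}) ω :=
    measurable_pi_lambda _ fun b => hM.measurable _ (g.measurableSet_preimage _) (measure_lt_top _ _)
  convert h1.measurable.comp h2 using 1
  ext ω
  exact (Finset.sum_coe_sort g.range (fun b => M (g ⁻¹' {b}) ω • F b)).symm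

instance : CompleteSpace (Sobolev d s p) := by
  have hiso : Isometry (Sobolev.toLpEquiv : Sobolev d s p ≃ₗ[ℂ] _) :=
    AddMonoidHomClass.isometry_of_norm _ fun _ => rfl
  have := hiso.isUniformInducing.completeSpace_congr Sobolev.toLpEquiv.surjective
  exact this.2 inferInstance

/-- The indicator `1_{[y, 1]}` as an element of `L^p`. -/
def boxLp (p : ℝ≥0∞) (y : unitCube d) : Lp ℂ p (volume : Measure (EuclideanSpace ℝ (Fin d))) :=
  (memLp_boxFun y.1 p).toLp

/-- The case `s = 0` of `exists_boxVec`, where the Bessel potential is the identity. -/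
theorem exists_norm_boxLp_sub_le (d : ℕ) (hp : 2 ≤ p) (hp_top : p ≠ ∞) :
    ∃ C δ : ℝ, 0 ≤ C ∧ 0 < δ ∧
      ∀ (y y' : unitCube d) (h : ℝ), 0 ≤ h → h ≤ 1 → (∀ i, |y.1 i - y'.1 i| ≤ h) →
        ‖boxLp p y - boxLp p y'‖ ≤ C * h ^ δ := by
  have hq : 2 ≤ p.toReal := by simpa using ENNReal.toReal_mono hp_top hp
  obtain ⟨v, C, δ, hC, hδ, hv, H⟩ := exists_boxVec (s := 0) d hp hp_top (by positivity)
  refine ⟨C, δ, hC, hδ, fun y y' h h0 h1 hyy => ?_⟩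
  refine le_trans (le_of_eq ?_) (H y y' h h0 h1 hyy)
  have e : ∀ y, (v y).toLpFun = boxLp p y := fun y => Sobolev.toLpFun_eq (by rw [hv]; simp [boxLp])
  have e2 : (v y - v y').toLpFun = (v y).toLpFun - (v y').toLpFun :=
    map_sub (Sobolev.toLpEquiv : Sobolev d 0 p ≃ₗ[ℂ] _) _ _
  rw [Sobolev.norm_eq, e2, e, e]

theorem toDistribution_vectorIntegral {Ω : Type*} {M : Set (unitCube d) → Ω → ℝ}
    {v : unitCube d → Sobolev d s p}
    (hv : ∀ y, (v y).toDistribution = Lp.toTemperedDistribution (boxLp p y))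
    (g : SimpleFunc (unitCube d) (unitCube d)) (ω : Ω) :
    (vectorIntegral M g v ω).toDistribution =
      Lp.toTemperedDistribution (vectorIntegral M g (boxLp p) ω) := by
  simp only [vectorIntegral]
  change Sobolev.toDistributionHom _ = Lp.toTemperedDistributionCLM ℂ volume p _
  rw [map_sum, map_sum]
  refine Finset.sum_congr rfl fun y _ => ?_
  have h1 : Sobolev.toDistributionHom (M (g ⁻¹' {y}) ω • v y) =
      (M (g ⁻¹' {y}) ω : ℂ) • (v y).toDistribution := rfl
  have h2 : (M (g ⁻¹' {y}) ω) • boxLp p y = (M (g ⁻¹' {y}) ω : ℂ) • boxLp p y :=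
    (Complex.coe_smul _ _).symm
  rw [h1, h2, map_smul, hv]
  rfl

/-- If `T_n → f` in `L^p` and the corresponding elements of `H^s_p` converge, then the limits
agree as distributions. -/
theorem toDistribution_eq_of_tendsto {X : ℕ → Sobolev d s p} {Y : Sobolev d s p}
    {f : ℕ → Lp ℂ p (volume : Measure (EuclideanSpace ℝ (Fin d)))} {f' : Lp ℂ p volume}
    (h : ∀ n, (X n).toDistribution = Lp.toTemperedDistribution (f n))
    (hX : Tendsto X atTop (𝓝 Y)) (hf : Tendsto f atTop (𝓝 f')) :
    Y.toDistribution = Lp.toTemperedDistribution f' := by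
  have hiso : Isometry (Sobolev.toLpEquiv : Sobolev d s p ≃ₗ[ℂ] _) :=
    AddMonoidHomClass.isometry_of_norm _ fun _ => rfl
  have h1 : Tendsto (fun n => (X n).toLpFun) atTop (𝓝 Y.toLpFun) :=
    (hiso.continuous.tendsto Y).comp hX
  have h2 := ((Lp.toTemperedDistributionCLM ℂ (volume : Measure (EuclideanSpace ℝ (Fin d)))
    p).continuous.tendsto _).comp h1
  have h3 := ((besselPotential (EuclideanSpace ℝ (Fin d)) ℂ s ∘L Lp.toTemperedDistributionCLM ℂ
    (volume : Measure (EuclideanSpace ℝ (Fin d))) p).continuous.tendsto _).comp hf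
  -- The Bessel potentials converge as distributions along both routes, through the `H^s_p` norm and
  -- through `L^p`. Uniqueness of limits identifies them, and the potential of order `-s` undoes the
  -- operator.
  have h4 : besselPotential (EuclideanSpace ℝ (Fin d)) ℂ s Y.toDistribution =
      besselPotential (EuclideanSpace ℝ (Fin d)) ℂ s (Lp.toTemperedDistribution f') := by
    rw [Sobolev.besselPotential_eq]
    refine tendsto_nhds_unique h2 (h3.congr fun n => ?_)
    simp only [Function.comp_apply, ContinuousLinearMap.comp_apply,
      Lp.toTemperedDistributionCLM_apply, ← h, Sobolev.besselPotential_eq]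
  simpa using congrArg (besselPotential (EuclideanSpace ℝ (Fin d)) ℂ (-s)) h4

/-- The duality behind the proof: for `x`, `y` in the cube, `x ∈ [y,1]` exactly when `y` lies below
`x`. Outside the cube every box indicator vanishes. -/
theorem coeFn_vectorIntegral_boxLp {Ω : Type*} {M : Set (unitCube d) → Ω → ℝ} (n : ℕ) (ω : Ω) :
    (vectorIntegral M (dyadicSimple d n) (boxLp p) ω : Lp ℂ p volume) =ᵐ[volume]
      zeroExtension (discreteSheet M n) ω := by
  have h1 : ∀ᵐ x ∂(volume : Measure (EuclideanSpace ℝ (Fin d))),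
      ∀ y ∈ (dyadicSimple d n).range, (M (dyadicSimple d n ⁻¹' {y}) ω • boxLp p y :
        Lp ℂ p volume) x = M (dyadicSimple d n ⁻¹' {y}) ω • boxFun y.1 x := by
    refine (Finset.eventually_all _).2 fun y _ => ?_
    filter_upwards [Lp.coeFn_smul (M (dyadicSimple d n ⁻¹' {y}) ω) (boxLp p y),
      (memLp_boxFun y.1 p).coeFn_toLp] with x hx hx'
    rw [hx, Pi.smul_apply]
    exact congrArg _ hx'
  filter_upwards [h1, Lp.coeFn_finsetSum (dyadicSimple d n).range
    fun y => M (dyadicSimple d n ⁻¹' {y}) ω • boxLp p y] with x h1 h2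
  rw [vectorIntegral, h2, Finset.sum_apply, Finset.sum_congr rfl h1]
  by_cases hx : x ∈ unitCube d
  · have : zeroExtension (discreteSheet M n) ω x = discreteSheet M n ⟨x, hx⟩ ω :=
      Subtype.val_injective.extend_apply _ _ (⟨x, hx⟩ : unitCube d)
    rw [this, discreteSheet, vectorIntegral]
    push_cast
    refine Finset.sum_congr rfl fun y _ => ?_
    rw [Complex.real_smul]
    by_cases h : ∀ i, y.1 i ≤ x i
    · have h1 : x ∈ upperBox y.1 := fun i => ⟨h i, (hx i).2⟩
      have h2 : y ∈ lowerBox ⟨x, hx⟩ := h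
      simp [boxFun, h1, h2]
    · have h1 : x ∉ upperBox y.1 := fun h' => h fun i => (h' i).1
      have h2 : y ∉ lowerBox ⟨x, hx⟩ := h
      simp [boxFun, h1, h2]
  · have : zeroExtension (discreteSheet M n) ω x = 0 := by
      refine Function.extend_apply' _ _ _ ?_
      rintro ⟨y, rfl⟩
      exact hx y.2
    rw [this]
    refine Finset.sum_eq_zero fun y _ => ?_
    have h1 : x ∉ upperBox y.1 := fun h' => hx fun i => ⟨(y.2 i).1.trans (h' i).1, (h' i).2⟩
    simp [boxFun, h1]

/-- Almost surely, the discretized sheets converge almost everywhere to any measurable version. -/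
theorem ae_ae_tendsto_zeroExtension [IsProbabilityMeasure P] (hα : 0 < α) {U V : unitCube d → Ω → ℝ}
    (hM : IsSymStableRandomMeasure α (lebesgue d) P M)
    (hU : ∀ x, IsStochasticIntegral α (lebesgue d) P M (sheetKernel x) (U x))
    (hV : IsMeasurableVersion P U V) :
    ∀ᵐ ω ∂P, ∀ᵐ x ∂(volume : Measure (EuclideanSpace ℝ (Fin d))),
      Tendsto (fun n => zeroExtension (discreteSheet M n) ω x) atTop
        (𝓝 (zeroExtension V ω x)) := by
  have hmeas : MeasurableSet {q : unitCube d × Ω |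
      Tendsto (fun n => discreteSheet M n q.1 q.2 - V q.1 q.2) atTop (𝓝 0)} :=
    measurableSet_tendsto _ fun n => (measurable_discreteSheet hM n).sub hV.measurable
  have h1 : ∀ᵐ x ∂(lebesgue d), ∀ᵐ ω ∂P,
      Tendsto (fun n => discreteSheet M n x ω - V x ω) atTop (𝓝 0) := by
    refine ae_of_all _ fun x => ?_
    filter_upwards [ae_tendsto_discreteSheet hα hM hU x, hV.ae_eq x] with ω h1 h2
    rw [h2]
    simpa using h1.sub_const (U x ω)
  -- Fubini: for each `x` there is an exceptional null set of `ω`; joint measurability exchanges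
  -- these for one null set of `ω` with an exceptional null set of `x` for each other `ω`.
  rw [Measure.ae_ae_comm hmeas] at h1
  filter_upwards [h1] with ω hω
  rw [lebesgue] at hω
  have h2 : ∀ᵐ x ∂(volume : Measure (EuclideanSpace ℝ (Fin d))).restrict (unitCube d),
      Tendsto (fun n => zeroExtension (discreteSheet M n) ω x) atTop
        (𝓝 (zeroExtension V ω x)) := by
    rw [ae_restrict_iff_subtype measurableSet_unitCube]
    filter_upwards [hω] with x hx
    have e : ∀ W : unitCube d → Ω → ℝ, zeroExtension W ω x = W x ω := fun W =>
      Subtype.val_injective.extend_apply _ _ x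
    simp only [e]
    refine (Complex.continuous_ofReal.tendsto _).comp ?_
    simpa using hx.add_const (V x ω)
  rw [ae_restrict_iff' measurableSet_unitCube] at h2
  filter_upwards [h2] with x hx
  by_cases hxc : x ∈ unitCube d
  · exact hx hxc
  · have e : ∀ W : unitCube d → Ω → ℝ, zeroExtension W ω x = 0 := fun W => by
      refine Function.extend_apply' _ _ _ ?_
      rintro ⟨y, rfl⟩
      exact hxc y.2
    simp only [e]
    exact tendsto_const_nhds

end Sheet

end StableSheet

end

/-! ### Identification of the `H^s_p` limit with the sample path -/

theorem mainTheorem5 (d : ℕ) (α : ℝ) (hα : α ∈ Set.Ioo (0 : ℝ) 2)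
    (p : ℝ≥0∞) [Fact (1 ≤ p)] (hp : 2 ≤ p) (hp_top : p ≠ ∞)
    {Ω : Type*} [MeasurableSpace Ω] (P : Measure Ω) [IsProbabilityMeasure P]
    (U : StableSheet.unitCube d → Ω → ℝ) (hU : StableSheet.IsSymStableSheet α P U) :
    (∃ V, StableSheet.IsMeasurableVersion P U V) ∧
      ∀ V, StableSheet.IsMeasurableVersion P U V → ∀ s : ℝ, s < 1 / p.toReal →
        ∃ X : Ω → StableSheet.Sobolev d s p, Measurable X ∧
          ∀ᵐ ω ∂P, ∃ h : MemLp (StableSheet.zeroExtension V ω) p volume,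
            (X ω).toDistribution = Lp.toTemperedDistribution h.toLp := by
  obtain ⟨M, hM, hUM⟩ := hU.exists_integral
  refine ⟨StableSheet.exists_measurableVersion hα.1 hM hUM, fun V hV s hs => ?_⟩
  obtain ⟨K, hK⟩ := StableSheet.isTwoSmooth_Lp
    (volume : Measure (EuclideanSpace ℝ (Fin d))) hp hp_top
  have hK' : StableSheet.IsTwoSmooth (StableSheet.Sobolev d s p) K :=
    hK.of_norm_map (StableSheet.Sobolev.toLpEquiv : StableSheet.Sobolev d s p ≃ₗ[ℂ] _
      ).toAddEquiv.toAddMonoidHom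
      fun _ => rfl
  obtain ⟨v, C, δ, hC, hδ, hv, hvC⟩ := StableSheet.exists_boxVec d hp hp_top hs
  obtain ⟨C', δ', hC', hδ', hwC⟩ := StableSheet.exists_norm_boxLp_sub_le d hp hp_top
  have h1 := StableSheet.ae_cauchySeq_vectorIntegral hM hα.1 hK' hC hδ hvC
  have h2 := StableSheet.ae_cauchySeq_vectorIntegral hM hα.1 hK hC' hδ' hwC
  obtain ⟨X, hXm, hX⟩ := measurable_limit_of_tendsto_metrizable_ae
    (fun n => (StableSheet.measurable_vectorIntegral hM (StableSheet.dyadicSimple d n) v).aemeasurable)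
    (h1.mono fun ω h => cauchySeq_tendsto_of_complete h)
  refine ⟨X, hXm, ?_⟩
  filter_upwards [hX, h2, StableSheet.ae_ae_tendsto_zeroExtension hα.1 hM hUM hV] with ω hXω h2 h3
  obtain ⟨f, hf⟩ := cauchySeq_tendsto_of_complete h2
  have hd := StableSheet.toDistribution_eq_of_tendsto
    (fun n => StableSheet.toDistribution_vectorIntegral hv (StableSheet.dyadicSimple d n) ω) hXω hf
  -- Convergence in `L^p` gives almost everywhere convergence along a subsequence, whose limit must
  -- agree with the pointwise limit `V` of the discretized sheets.
  obtain ⟨ns, hns, hsub⟩ := (tendstoInMeasure_of_tendsto_Lp hf).exists_seq_tendsto_ae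
  have hfV : f =ᵐ[volume] StableSheet.zeroExtension V ω := by
    filter_upwards [h3, hsub, ae_all_iff.2 fun n =>
      StableSheet.coeFn_vectorIntegral_boxLp (M := M) (p := p) n ω] with x h3 h4 h5
    simp only [h5] at h4
    exact tendsto_nhds_unique h4 (h3.comp hns.tendsto_atTop)
  have hmem : MemLp (StableSheet.zeroExtension V ω) p volume := (memLp_congr_ae hfV).1 (Lp.memLp f)
  refine ⟨hmem, ?_⟩
  have : hmem.toLp = f := Lp.ext (hmem.coeFn_toLp.trans hfV.symm)
  rw [this]
  exact hd
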